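/- Let $1\le d<p$ be integers and $K>1$. For $\eta\ge 0$, $X\subset\mathbb R^n$ open and $g:X\to\mathbb R$ of class $C^{\lfloor\eta\rfloor}$, write $$\|g\|_{\mathcal H^\eta(X)}=\sum_{|\nu|\le\lfloor\eta\rfloor}\sup_X|\partial^\nu g|+\sum_{|\nu|=\lfloor\eta\rfloor}\ \sup_{x\ne y\in X}\frac{|\partial^\nu g(x)-\partial^\nu g(y)|}{\min\{1,\|x-y\|^{\eta-\lfloor\eta\rfloor}\}},$$ and let $\mathcal H^\eta_K(X,\mathbb R^m)$ be the set of $C^{\lfloor\eta\rfloor}$ maps $X\to\mathbb R^m$ each of whose components has norm at most $K$. For probability measures $\mu,\nu$ on $\mathbb R^p$ let $d_{\mathcal H^\eta_1}(\mu,\nu)=\sup\{\int h\,d\mu-\int h\,d\nu:\ h\in\mathcal H^\eta_1(\mathbb R^p,\mathbb R)\}$. A closed (compact, without boundary) $d$-dimensional embedded submanifold $\mathcal M\subset\mathbb R^p$ satisfies the $(s,K)$-manifold condition if $\mathcal M\subset B(0,K)$ and, for every $x\in\mathcal M$, the map $\varphi_x(z)=\pi_{T_x\mathcal M}(z-x)$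 (orthogonal projection onto the tangent space, which is identified with $\mathbb R^d$ by an orthonormal basis) is a diffeomorphism of $U_x=B(x,K^{-1})\cap\mathcal M$ onto its open image, with $\varphi_x^{-1}\in\mathcal H^s_K(\varphi_x(U_x),\mathbb R^p)$. A function $f:\mathcal M\to\mathbb R$ belongs to $\mathcal H^s_K(\mathcal M,\mathbb R)$ if, for every $x\in\mathcal M$, $f\circ\varphi_x^{-1}\in\mathcal H^s_K(\varphi_x(U_x),\mathbb R)$. A probability measure satisfies the $(s,K)$-density condition on $\mathcal M$ if it has a density $f\in\mathcal H^s_K(\mathcal M,\mathbb R)$ with respect to the volume ($d$-dimensional Hausdorff) measure of $\mathcal M$ and $f\ge K^{-1}$ on $\mathcal M$. **Proposition.** There is a constant $C>0$ depending only on $p,d,K$ and, for every $\eta>0$, a constant $C_\eta>0$ depending only on $p,d,K,\eta$, such that the following holds. Let $\mathcal M,\mathcal M^\star$ satisfy the $(2,K)$-manifold condition, with $\mathcal M$ connected. Let $\mu^\star$ be a probability measure satisfying the $(0,K)$-density condition on $\mathcal M^\star$, and let $\mu$ be a probability measure with a density $f_\mu\in\mathcal H^1_K(\mathcal M,\mathbb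 R)$, $f_\mu\ge 0$, with respect to the volume measure of $\mathcal M$. If $\inf_{\mathcal M}f_\mu\le C_\eta^{-1}$, then $$d_{\mathcal H^\eta_1}(\mu,\mu^\star)\ge C^{-1},$$ and consequently $d_{\mathcal H^\gamma_1}(\mu,\mu^\star)\le C\,d_{\mathcal H^\eta_1}(\mu,\mu^\star)$ for every $\gamma>0$. -/

import Mathlib

open MeasureTheory Set
open scoped ENNReal

noncomputable section

namespace HolderIPM

/-- The Euclidean space `ℝ^n`. -/
abbrev Eucl (n : ℕ) : Type := EuclideanSpace ℝ (Fin n)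

/-- The partial derivative `∂g/∂x_i`. -/
def partialDeriv {n : ℕ} (i : Fin n) (g : Eucl n → ℝ) : Eucl n → ℝ :=
  fun x => lineDeriv ℝ g x (EuclideanSpace.single i 1)

/-- The iterated partial derivative `∂^ν g = ∂^{|ν|} g / ∂x_1^{ν_1} ⋯ ∂x_n^{ν_n}` for a multi-index
`ν`. It is only used at points of an open set on which `g` is of class `C^{|ν|}`. -/
def multiDeriv {n : ℕ} (ν : Fin n → ℕ) (g : Eucl n → ℝ) : Eucl n → ℝ :=
  (List.finRange n).foldr (fun i h => (partialDeriv i)^[ν i] h) g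

/-- The supremum norm `sup_{x ∈ X} |g(x)|`. -/
def supNormOn {n : ℕ} (X : Set (Eucl n)) (g : Eucl n → ℝ) : ℝ≥0∞ :=
  ⨆ x ∈ X, ENNReal.ofReal |g x|

/-- The seminorm `sup_{x ≠ y in X} |g(x) - g(y)| / min {1, ‖x - y‖^s}`. -/
def holderSeminormOn {n : ℕ} (s : ℝ) (X : Set (Eucl n)) (g : Eucl n → ℝ) : ℝ≥0∞ :=
  ⨆ x ∈ X, ⨆ y ∈ X, ⨆ _ : x ≠ y, ENNReal.ofReal (|g x - g y| / min 1 (‖x - y‖ ^ s))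

/-- The Hölder norm of order `η` on `X`: the sum of `‖∂^ν g‖_∞` over all multi-indices
`|ν| ≤ ⌊η⌋`, plus the sum of the `(η - ⌊η⌋)`-seminorms of `∂^ν g` over `|ν| = ⌊η⌋`.
Here `Finset.piAntidiag Finset.univ k` is the set of the multi-indices `ν` with `|ν| = k`. -/
def holderNormOn {n : ℕ} (η : ℝ) (X : Set (Eucl n)) (g : Eucl n → ℝ) : ℝ≥0∞ :=
  (∑ k ∈ Finset.range (⌊η⌋₊ + 1), ∑ ν ∈ Finset.piAntidiag (Finset.univ : Finset (Fin n)) k,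
      supNormOn X (multiDeriv ν g))
    + ∑ ν ∈ Finset.piAntidiag (Finset.univ : Finset (Fin n)) ⌊η⌋₊,
        holderSeminormOn (η - ⌊η⌋₊) X (multiDeriv ν g)

/-- `g` belongs to the Hölder ball `H^η_K(X, ℝ)`, for an open set `X ⊆ ℝ^n`. -/
def InHolderBall {n : ℕ} (η K : ℝ) (X : Set (Eucl n)) (g : Eucl n → ℝ) : Prop :=
  ContDiffOn ℝ (⌊η⌋₊ : ℕ) g X ∧ holderNormOn η X g ≤ ENNReal.ofReal K

/-- `g` belongs to the Hölder ball `H^η_K(X, ℝ^m)`: the maximum over the components of `g` of the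
Hölder norms is at most `K`. -/
def InHolderBallVec {n m : ℕ} (η K : ℝ) (X : Set (Eucl n)) (g : Eucl n → Eucl m) : Prop :=
  ∀ i : Fin m, InHolderBall η K X (fun x => g x i)

/-- The Hölder integral probability metric
`d_{H^η_1}(μ, ν) = sup {∫ h dμ - ∫ h dν : h ∈ H^η_1(ℝ^p, ℝ)}`. (For probability measures the set
is nonempty and bounded by `2`, since its members satisfy `|h| ≤ 1`.) -/
def holderIPM {p : ℕ} (η : ℝ) (μ ν : Measure (Eucl p)) : ℝ :=
  sSup {r : ℝ | ∃ h : Eucl p → ℝ, InHolderBall η 1 univ h ∧ r = ∫ x, h x ∂μ - ∫ x, h x ∂ν}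

/-- `M` is a closed (i.e. compact, without boundary) `d`-dimensional embedded submanifold of `ℝ^p`:
a compact set that locally, in suitable `C^1` coordinates of `ℝ^p`, is a `d`-dimensional linear
subspace. (Higher regularity is imposed by `ManifoldCondition`.) -/
def IsClosedSubmanifold {p : ℕ} (d : ℕ) (M : Set (Eucl p)) : Prop :=
  IsCompact M ∧ ∀ x ∈ M, ∃ (Φ : OpenPartialHomeomorph (Eucl p) (Eucl p))
    (L : Submodule ℝ (Eucl p)),
      x ∈ Φ.source ∧ ContDiffOn ℝ 1 Φ Φ.source ∧ ContDiffOn ℝ 1 Φ.symm Φ.target ∧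
      Module.finrank ℝ L = d ∧ ∀ z ∈ Φ.source, z ∈ M ↔ Φ z ∈ L

/-- The (linear) tangent space `T_x M`. -/
def tangentSpaceAt {p : ℕ} (M : Set (Eucl p)) (x : Eucl p) : Submodule ℝ (Eucl p) :=
  Submodule.span ℝ (tangentConeAt ℝ M x)

/-- The neighbourhood `U_x = B(x, 1/K) ∩ M` of `x` in `M`. -/
def chartDomain {p : ℕ} (K : ℝ) (M : Set (Eucl p)) (x : Eucl p) : Set (Eucl p) :=
  Metric.ball x K⁻¹ ∩ M

/-- The chart `φ_x`: the orthogonal projection of `z - x` onto `T_x M`, where `T_x M` is identified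
with `ℝ^d` through an orthonormal basis `b`. -/
def chart {p d : ℕ} (M : Set (Eucl p)) (x : Eucl p)
    (b : OrthonormalBasis (Fin d) ℝ (tangentSpaceAt M x)) (z : Eucl p) : Eucl d :=
  b.repr ((tangentSpaceAt M x).orthogonalProjectionOnto (z - x))

/-- The inverse `φ_x⁻¹ : φ_x(U_x) → U_x` of the chart restricted to `U_x`. -/
def chartInv {p d : ℕ} (K : ℝ) (M : Set (Eucl p)) (x : Eucl p)
    (b : OrthonormalBasis (Fin d) ℝ (tangentSpaceAt M x)) : Eucl d → Eucl p :=
  Function.invFunOn (chart M x b) (chartDomain K M x)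

/-- The `(s, K)`-manifold condition for a `d`-dimensional submanifold `M` of `ℝ^p`: `M` is a closed
submanifold contained in `B(0, K)` and, for every `x ∈ M`, the map `φ_x` is a diffeomorphism of
`U_x` onto its (open) image in `T_x M`, with `φ_x⁻¹ ∈ H^s_K(φ_x(U_x), U_x)`. -/
structure ManifoldCondition {p : ℕ} (d : ℕ) (s K : ℝ) (M : Set (Eucl p)) : Prop where
  closedSubmanifold : IsClosedSubmanifold d M
  subset_ball : M ⊆ Metric.ball 0 K
  chart_regular : ∀ x ∈ M, ∃ b : OrthonormalBasis (Fin d) ℝ (tangentSpaceAt M x),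
    InjOn (chart M x b) (chartDomain K M x) ∧
    IsOpen (chart M x b '' chartDomain K M x) ∧
    ContDiffOn ℝ 1 (chartInv K M x b) (chart M x b '' chartDomain K M x) ∧
    InHolderBallVec s K (chart M x b '' chartDomain K M x) (chartInv K M x b)

/-- `f` (a function on `M`, its values outside `M` being irrelevant) belongs to the Hölder ball
`H^s_K(M, ℝ)`: it is so when read in the charts `φ_x`. -/
def InHolderBallManifold {p : ℕ} (d : ℕ) (s K : ℝ) (M : Set (Eucl p)) (f : Eucl p → ℝ) : Prop :=
  ∀ x ∈ M, ∃ b : OrthonormalBasis (Fin d) ℝ (tangentSpaceAt M x),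
    InHolderBall s K (chart M x b '' chartDomain K M x) (fun u => f (chartInv K M x b u))

/-- The volume measure on a `d`-dimensional submanifold: the restriction to `M` of the
`d`-dimensional Hausdorff measure (normalised so that it is Lebesgue measure on `ℝ^d`). -/
def volumeOn {p : ℕ} (d : ℕ) (M : Set (Eucl p)) : Measure (Eucl p) :=
  (Measure.euclideanHausdorffMeasure d).restrict M

/-- `f` is a density of `μ` with respect to the volume measure on `M`. -/
def IsDensityOn {p : ℕ} (d : ℕ) (M : Set (Eucl p)) (μ : Measure (Eucl p)) (f : Eucl p → ℝ) : Prop :=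
  (∀ x ∈ M, 0 ≤ f x) ∧ μ = (volumeOn d M).withDensity (fun x => ENNReal.ofReal (f x))

/-- The `(s, K)`-density condition: `μ` has a density in `H^s_K(M, ℝ)` with respect to the volume
measure on `M`, and this density is bounded below by `1/K` on `M`. -/
def DensityCondition {p : ℕ} (d : ℕ) (s K : ℝ) (M : Set (Eucl p)) (μ : Measure (Eucl p)) : Prop :=
  ∃ f : Eucl p → ℝ, IsDensityOn d M μ f ∧ InHolderBallManifold d s K M f ∧ ∀ x ∈ M, K⁻¹ ≤ f x

end HolderIPM

end

/-! The difficulty is that C may not depend on η, although the unit ball of test functions shrinks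
as η grows. Test functions lying in every ball at once are therefore needed. Plane waves a cos(⟨b,
x⟩ + θ) with ∑ |b i| ≤ 1/2 and |a| ≤ 1/4 are such: differentiation multiplies the amplitude by
powers of b, and the sum over all multi-indices is a convergent geometric series
(`holderNormOn_planeWave_le`).

On a compact set these waves span a dense subspace of the continuous functions
(`lowFrequencySpan_eq_top`): derivatives in b at small frequencies produce multiplication by
coordinates, and Stone–Weierstrass applies. A fixed continuous bump is thus approximated within ε by
a finite combination of waves. Translating the bump only changes phases, so the difference of its
integrals is at most A · d_η + ε with A independent of η, of the centre and of the measures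
(`exists_abs_integral_sub_le`).

It remains to separate the measures by finitely many bump shapes
(`exists_le_abs_integral_bump_sub`). Volumes are uniformly bounded, so the density of μ cannot stay
below a small level t; by connectedness it equals t at some x₀, and by the Lipschitz bound it is
comparable to t near x₀. Either the other manifold misses a ball about x₀, where μ has mass, or it
comes close to x₀, and then μstar has far more mass there than μ. Volumes of balls are compared with
Euclidean ones through the charts, whose images contain balls of controlled radius. -/

namespace HolderIPM

/-! ### Hölder norms of plane waves -/

/-- The plane wave `x ↦ a cos (⟨b, x⟩ + θ)`. -/
noncomputable def planeWave {n : ℕ} (a : ℝ) (b : Eucl n) (θ : ℝ) : Eucl n → ℝ :=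
  fun x => a * Real.cos (inner ℝ b x + θ)

lemma contDiff_planeWave {n : ℕ} (a : ℝ) (b : Eucl n) (θ : ℝ) (m : WithTop ℕ∞) :
    ContDiff ℝ m (planeWave a b θ) := by
  exact contDiff_const.mul (Real.contDiff_cos.comp
    ((contDiff_const.inner ℝ contDiff_id).add contDiff_const))

lemma abs_planeWave_le {n : ℕ} (a : ℝ) (b : Eucl n) (θ : ℝ) (x : Eucl n) :
    |planeWave a b θ x| ≤ |a| := by
  rw [planeWave, abs_mul]
  exact mul_le_of_le_one_right (abs_nonneg a) (Real.abs_cos_le_one _)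

lemma partialDeriv_planeWave {n : ℕ} (a : ℝ) (b : Eucl n) (θ : ℝ) (i : Fin n) :
    partialDeriv i (planeWave a b θ) = planeWave (a * b i) b (θ + Real.pi / 2) := by
  ext x
  have h1 : ∀ t : ℝ, inner ℝ b (x + t • EuclideanSpace.single i (1 : ℝ)) + θ
      = (inner ℝ b x + θ) + t * b i := by
    intro t
    rw [inner_add_right, inner_smul_right, EuclideanSpace.inner_single_right]
    simp
    ring
  simp only [partialDeriv, lineDeriv, planeWave]
  simp_rw [h1]
  have h2 : HasDerivAt (fun t : ℝ => (inner ℝ b x + θ) + t * b i) (1 * b i) 0 :=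
    ((hasDerivAt_id (0 : ℝ)).mul_const (b i)).const_add _
  rw [(h2.cos.const_mul a).deriv, ← add_assoc, Real.cos_add_pi_div_two]
  simp
  ring

lemma iterate_partialDeriv_planeWave {n : ℕ} (a : ℝ) (b : Eucl n) (θ : ℝ) (i : Fin n) (k : ℕ) :
    (partialDeriv i)^[k] (planeWave a b θ) =
      planeWave (a * b i ^ k) b (θ + k * (Real.pi / 2)) := by
  induction k with
  | zero => simp
  | succ k ih =>
    rw [Function.iterate_succ_apply', ih, partialDeriv_planeWave]
    congr 1
    · ring
    · push_cast; ring

/-- Each derivative contributes a factor `b i` and a phase shift of π/2. Only the amplitude enters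
the norms, so the phase is left unspecified. -/
lemma exists_multiDeriv_planeWave {n : ℕ} (a : ℝ) (b : Eucl n) (θ : ℝ) (ν : Fin n → ℕ) :
    ∃ θ', multiDeriv ν (planeWave a b θ) = planeWave (a * ∏ i, b i ^ ν i) b θ' := by
  have key : ∀ l : List (Fin n), ∃ θ',
      l.foldr (fun i h => (partialDeriv i)^[ν i] h) (planeWave a b θ) =
        planeWave (a * (l.map fun i => b i ^ ν i).prod) b θ' := by
    intro l
    induction l with
    | nil => exact ⟨θ, by simp⟩
    | cons i l ih =>
      obtain ⟨θ', h⟩ := ih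
      refine ⟨θ' + ν i * (Real.pi / 2), ?_⟩
      rw [List.foldr_cons, h, iterate_partialDeriv_planeWave, List.map_cons, List.prod_cons]
      congr 1
      ring
  obtain ⟨θ', h⟩ := key (List.finRange n)
  exact ⟨θ', by rw [multiDeriv, h, ← Fin.prod_univ_def]⟩

lemma supNormOn_planeWave_le {n : ℕ} (a : ℝ) (b : Eucl n) (θ : ℝ) (X : Set (Eucl n)) :
    supNormOn X (planeWave a b θ) ≤ ENNReal.ofReal |a| :=
  iSup₂_le fun x _ => ENNReal.ofReal_le_ofReal (abs_planeWave_le a b θ x)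

lemma norm_le_sum_abs {n : ℕ} (b : Eucl n) : ‖b‖ ≤ ∑ i, |b i| := by
  conv_lhs => rw [← (EuclideanSpace.basisFun (Fin n) ℝ).sum_repr b]
  refine (norm_sum_le _ _).trans (Finset.sum_le_sum fun i _ => ?_)
  simp [norm_smul]

lemma abs_planeWave_sub_le {n : ℕ} (a : ℝ) (b : Eucl n) (θ : ℝ) (hb : ‖b‖ ≤ 1) (x y : Eucl n) :
    |planeWave a b θ x - planeWave a b θ y| ≤ |a| * ‖x - y‖ := by
  rw [planeWave, planeWave, ← mul_sub, abs_mul]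
  gcongr
  have h := Real.lipschitzWith_cos.dist_le_mul (inner ℝ b x + θ) (inner ℝ b y + θ)
  rw [Real.dist_eq, Real.dist_eq] at h
  refine h.trans ?_
  rw [NNReal.coe_one, one_mul, add_sub_add_right_eq_sub, ← inner_sub_right]
  exact (abs_real_inner_le_norm _ _).trans (mul_le_of_le_one_left (norm_nonneg _) hb)

/-- At distance at least 1 the sup bound suffices; at smaller distances the Lipschitz bound does,
since r ≤ r ^ s for r ≤ 1 and s ≤ 1. -/
lemma holderSeminormOn_planeWave_le {n : ℕ} (a : ℝ) (b : Eucl n) (θ : ℝ) (hb : ‖b‖ ≤ 1)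
    {s : ℝ} (hs : s ≤ 1) (hs0 : 0 ≤ s) (X : Set (Eucl n)) :
    holderSeminormOn s X (planeWave a b θ) ≤ ENNReal.ofReal (2 * |a|) := by
  refine iSup₂_le fun x _ => iSup₂_le fun y _ => iSup_le fun hxy => ENNReal.ofReal_le_ofReal ?_
  have hpos : 0 < ‖x - y‖ := norm_pos_iff.2 (sub_ne_zero.2 hxy)
  have ha := abs_nonneg a
  rcases le_total 1 ‖x - y‖ with h | h
  · rw [min_eq_left (Real.one_le_rpow h hs0), div_one]
    have := abs_sub (planeWave a b θ x) (planeWave a b θ y)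
    linarith [abs_planeWave_le a b θ x, abs_planeWave_le a b θ y]
  · rw [min_eq_right (Real.rpow_le_one hpos.le h hs0), div_le_iff₀ (Real.rpow_pos_of_pos hpos s)]
    have h2 : ‖x - y‖ ≤ ‖x - y‖ ^ s := by
      simpa using Real.rpow_le_rpow_of_exponent_ge hpos h hs
    calc |planeWave a b θ x - planeWave a b θ y| ≤ |a| * ‖x - y‖ := abs_planeWave_sub_le a b θ hb x y
      _ ≤ |a| * ‖x - y‖ ^ s := by gcongr
      _ ≤ 2 * |a| * ‖x - y‖ ^ s := by
        have : 0 ≤ |a| * ‖x - y‖ ^ s := by positivity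
        linarith

/-- The multinomial theorem, with every multinomial coefficient at least 1. -/
lemma sum_piAntidiag_abs_prod_pow_le {n : ℕ} (b : Eucl n) (k : ℕ) :
    ∑ ν ∈ Finset.piAntidiag (Finset.univ : Finset (Fin n)) k, |∏ i, b i ^ ν i|
      ≤ (∑ i, |b i|) ^ k := by
  rw [Finset.sum_pow_eq_sum_piAntidiag]
  refine Finset.sum_le_sum fun ν _ => ?_
  rw [Finset.abs_prod]
  simp_rw [abs_pow]
  refine le_mul_of_one_le_left (Finset.prod_nonneg fun i _ => by positivity) ?_
  exact_mod_cast Nat.multinomial_pos _ _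

/-- Order k contributes at most |a| / 2 ^ k. The sup norms sum to at most 2|a| wherever the sum
stops, and the seminorms add at most 2|a|, so the bound does not involve η. -/
lemma holderNormOn_planeWave_le {n : ℕ} (a : ℝ) (b : Eucl n) (θ : ℝ) (hb : ∑ i, |b i| ≤ 1 / 2)
    {η : ℝ} (hη : 0 ≤ η) (X : Set (Eucl n)) :
    holderNormOn η X (planeWave a b θ) ≤ ENNReal.ofReal (4 * |a|) := by
  have hb0 : 0 ≤ ∑ i, |b i| := Finset.sum_nonneg fun i _ => abs_nonneg _
  have hb1 : ‖b‖ ≤ 1 := (norm_le_sum_abs b).trans (hb.trans (by norm_num))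
  have hsum : ∀ k, ∑ ν ∈ Finset.piAntidiag (Finset.univ : Finset (Fin n)) k,
      |a * ∏ i, b i ^ ν i| ≤ |a| * (1 / 2) ^ k := by
    intro k
    simp_rw [abs_mul]
    rw [← Finset.mul_sum]
    gcongr
    exact (sum_piAntidiag_abs_prod_pow_le b k).trans (pow_le_pow_left₀ hb0 hb k)
  have h1 : ∀ k, ∑ ν ∈ Finset.piAntidiag (Finset.univ : Finset (Fin n)) k,
      supNormOn X (multiDeriv ν (planeWave a b θ)) ≤ ENNReal.ofReal (|a| * (1 / 2) ^ k) := by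
    intro k
    refine le_trans ?_ (ENNReal.ofReal_le_ofReal (hsum k))
    rw [ENNReal.ofReal_sum_of_nonneg fun _ _ => abs_nonneg _]
    refine Finset.sum_le_sum fun ν _ => ?_
    obtain ⟨θ', h⟩ := exists_multiDeriv_planeWave a b θ ν
    rw [h]
    exact supNormOn_planeWave_le _ _ _ _
  have h2 : ∑ ν ∈ Finset.piAntidiag (Finset.univ : Finset (Fin n)) ⌊η⌋₊,
      holderSeminormOn (η - ⌊η⌋₊) X (multiDeriv ν (planeWave a b θ))
        ≤ ENNReal.ofReal (2 * |a|) := by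
    have : 2 * ∑ ν ∈ Finset.piAntidiag (Finset.univ : Finset (Fin n)) ⌊η⌋₊,
        |a * ∏ i, b i ^ ν i| ≤ 2 * |a| := by
      have := hsum ⌊η⌋₊
      have h3 : |a| * (1 / 2 : ℝ) ^ ⌊η⌋₊ ≤ |a| :=
        mul_le_of_le_one_right (abs_nonneg a) (pow_le_one₀ (by norm_num) (by norm_num))
      linarith
    refine le_trans ?_ (ENNReal.ofReal_le_ofReal this)
    rw [Finset.mul_sum, ENNReal.ofReal_sum_of_nonneg fun _ _ => by positivity]
    refine Finset.sum_le_sum fun ν _ => ?_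
    obtain ⟨θ', h⟩ := exists_multiDeriv_planeWave a b θ ν
    rw [h]
    refine holderSeminormOn_planeWave_le _ _ _ hb1 ?_ ?_ _
    · linarith [Nat.lt_floor_add_one η]
    · linarith [Nat.floor_le hη]
  have h3 : ∑ k ∈ Finset.range (⌊η⌋₊ + 1), ENNReal.ofReal (|a| * (1 / 2) ^ k)
      ≤ ENNReal.ofReal (2 * |a|) := by
    rw [← ENNReal.ofReal_sum_of_nonneg fun _ _ => by positivity]
    refine ENNReal.ofReal_le_ofReal ?_
    rw [← Finset.mul_sum, mul_comm]
    gcongr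
    exact sum_geometric_two_le _
  rw [holderNormOn, show 4 * |a| = 2 * |a| + 2 * |a| by ring,
    ENNReal.ofReal_add (by positivity) (by positivity)]
  exact add_le_add ((Finset.sum_le_sum fun k _ => h1 k).trans h3) h2

lemma inHolderBall_planeWave {n : ℕ} {a : ℝ} {b : Eucl n} (θ : ℝ) (ha : 4 * |a| ≤ 1)
    (hb : ∑ i, |b i| ≤ 1 / 2) {η : ℝ} (hη : 0 ≤ η) (X : Set (Eucl n)) :
    InHolderBall η 1 X (planeWave a b θ) :=
  ⟨(contDiff_planeWave a b θ _).contDiffOn,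
    (holderNormOn_planeWave_le a b θ hb hη X).trans (ENNReal.ofReal_le_ofReal ha)⟩

/-! ### Pointwise bounds from the Hölder norm -/

lemma multiDeriv_zero {n : ℕ} (g : Eucl n → ℝ) : multiDeriv 0 g = g := by
  have : ∀ l : List (Fin n),
      l.foldr (fun i h => (partialDeriv i)^[(0 : Fin n → ℕ) i] h) g = g := by
    intro l
    induction l with
    | nil => rfl
    | cons i l ih => rw [List.foldr_cons, ih]; rfl
  exact this _

lemma multiDeriv_single {n : ℕ} (i : Fin n) (g : Eucl n → ℝ) :
    multiDeriv (Pi.single i 1) g = partialDeriv i g := by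
  have : ∀ l : List (Fin n), l.Nodup →
      l.foldr (fun j h => (partialDeriv j)^[(Pi.single i 1 : Fin n → ℕ) j] h) g =
        if i ∈ l then partialDeriv i g else g := by
    intro l hl
    induction l with
    | nil => simp
    | cons j l ih =>
      rw [List.foldr_cons, ih (List.nodup_cons.1 hl).2]
      by_cases hj : j = i
      · subst hj
        simp [(List.nodup_cons.1 hl).1]
      · simp [hj, Ne.symm hj]
  rw [multiDeriv, this _ (List.nodup_finRange n), if_pos (List.mem_finRange i)]

lemma supNormOn_multiDeriv_le_holderNormOn {n : ℕ} {η : ℝ} {X : Set (Eucl n)} {g : Eucl n → ℝ}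
    {ν : Fin n → ℕ} (hν : ∑ i, ν i ≤ ⌊η⌋₊) :
    supNormOn X (multiDeriv ν g) ≤ holderNormOn η X g := by
  refine le_trans ?_ le_self_add
  refine le_trans ?_ (Finset.single_le_sum (f := fun k => ∑ ν ∈ Finset.piAntidiag Finset.univ k,
    supNormOn X (multiDeriv ν g)) (fun _ _ => zero_le)
    (Finset.mem_range.2 (Nat.lt_succ_of_le hν)))
  exact Finset.single_le_sum (f := fun ν => supNormOn X (multiDeriv ν g)) (fun _ _ => zero_le)
    (Finset.mem_piAntidiag.2 ⟨rfl, fun _ _ => Finset.mem_univ _⟩)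

lemma InHolderBall.abs_multiDeriv_le {n : ℕ} {η K : ℝ} {X : Set (Eucl n)} {g : Eucl n → ℝ}
    (hK : 0 ≤ K) (hg : InHolderBall η K X g) {ν : Fin n → ℕ} (hν : ∑ i, ν i ≤ ⌊η⌋₊)
    {x : Eucl n} (hx : x ∈ X) : |multiDeriv ν g x| ≤ K := by
  have h := (supNormOn_multiDeriv_le_holderNormOn (X := X) (g := g) hν).trans hg.2
  rw [← ENNReal.ofReal_le_ofReal_iff hK]
  exact (le_iSup₂ (f := fun x (_ : x ∈ X) => ENNReal.ofReal |multiDeriv ν g x|) x hx).trans h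

lemma InHolderBall.abs_le {n : ℕ} {η K : ℝ} {X : Set (Eucl n)} {g : Eucl n → ℝ}
    (hK : 0 ≤ K) (hg : InHolderBall η K X g) {x : Eucl n} (hx : x ∈ X) : |g x| ≤ K := by
  have := hg.abs_multiDeriv_le hK (ν := 0) (by simp) hx
  rwa [multiDeriv_zero] at this

lemma InHolderBall.abs_partialDeriv_le {n : ℕ} {η K : ℝ} {X : Set (Eucl n)} {g : Eucl n → ℝ}
    (hK : 0 ≤ K) (hη : 1 ≤ η) (hg : InHolderBall η K X g) (i : Fin n) {x : Eucl n} (hx : x ∈ X) :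
    |partialDeriv i g x| ≤ K := by
  have := hg.abs_multiDeriv_le hK (ν := Pi.single i 1)
    (by simpa [Finset.sum_pi_single'] using hη) hx
  rwa [multiDeriv_single] at this

/-! ### Integral probability metrics tested on plane waves -/

section IPM

variable {p : ℕ} {η : ℝ} (μ ν : Measure (Eucl p)) [IsProbabilityMeasure μ] [IsProbabilityMeasure ν]

lemma InHolderBall.integral_sub_integral_le_two {h : Eucl p → ℝ} (hh : InHolderBall η 1 univ h) :
    ∫ x, h x ∂μ - ∫ x, h x ∂ν ≤ 2 := by
  have h1 : ∀ ρ : Measure (Eucl p), IsProbabilityMeasure ρ → |∫ x, h x ∂ρ| ≤ 1 := by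
    intro ρ _
    have := norm_integral_le_of_norm_le_const (μ := ρ) (f := h) (C := 1)
      (Filter.Eventually.of_forall fun x => hh.abs_le zero_le_one (mem_univ x))
    simpa using this
  have h2 := _root_.abs_le.1 (h1 μ inferInstance)
  have h3 := _root_.abs_le.1 (h1 ν inferInstance)
  linarith

lemma holderIPM_le_two (hη : 0 ≤ η) : holderIPM η μ ν ≤ 2 := by
  refine csSup_le ⟨_, planeWave 0 0 0, inHolderBall_planeWave 0 (by simp) (by simp) hη univ, rfl⟩ ?_
  rintro r ⟨h, hh, rfl⟩
  exact hh.integral_sub_integral_le_two μ ν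

lemma InHolderBall.integral_sub_integral_le_holderIPM {h : Eucl p → ℝ}
    (hh : InHolderBall η 1 univ h) : ∫ x, h x ∂μ - ∫ x, h x ∂ν ≤ holderIPM η μ ν := by
  refine le_csSup ⟨2, ?_⟩ ⟨h, hh, rfl⟩
  rintro r ⟨h, hh, rfl⟩
  exact hh.integral_sub_integral_le_two μ ν

/-- Low frequency plane waves have Hölder norms bounded uniformly in the order, so their integrals
are controlled by every Hölder integral probability metric, with the same constant. -/
lemma abs_integral_planeWave_sub_le (hη : 0 ≤ η) {b : Eucl p} (hb : ∑ i, |b i| ≤ 1 / 2) (θ : ℝ) :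
    |∫ x, planeWave 1 b θ x ∂μ - ∫ x, planeWave 1 b θ x ∂ν| ≤ 4 * holderIPM η μ ν := by
  have key : ∀ a : ℝ, 4 * |a| ≤ 1 →
      a * (∫ x, planeWave 1 b θ x ∂μ - ∫ x, planeWave 1 b θ x ∂ν) ≤ holderIPM η μ ν := by
    intro a ha
    have := (inHolderBall_planeWave θ ha hb hη univ).integral_sub_integral_le_holderIPM μ ν
    simpa [planeWave, integral_const_mul, mul_sub] using this
  have h1 := key (1 / 4) (by norm_num [abs_of_pos])
  have h2 := key (-(1 / 4)) (by norm_num [abs_of_pos])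
  rw [abs_le]
  constructor <;> linarith

end IPM

open Filter Topology

/-! ### Density of low frequency plane waves -/

section Approximation

variable {p : ℕ}

lemma continuous_planeWave (a : ℝ) (b : Eucl p) (θ : ℝ) : Continuous (planeWave a b θ) :=
  (contDiff_planeWave a b θ 0).continuous

/-- The restriction of a plane wave of amplitude `1` to `S`. -/
noncomputable def planeWaveOn (S : Set (Eucl p)) (b : Eucl p) (θ : ℝ) : C(S, ℝ) :=
  ⟨fun x => planeWave 1 b θ x, (continuous_planeWave 1 b θ).comp continuous_subtype_val⟩

/-- The closed span, in the continuous functions on `S`, of the plane waves of low frequency. -/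
noncomputable def lowFrequencySpan (S : Set (Eucl p)) [CompactSpace S] : Submodule ℝ C(S, ℝ) :=
  (Submodule.span ℝ {g | ∃ (b : Eucl p) (θ : ℝ), ∑ i, |b i| < 1 / 2 ∧
    g = planeWaveOn S b θ}).topologicalClosure

/-- The restriction of a coordinate to `S`. -/
def coordOn (S : Set (Eucl p)) (j : Fin p) : C(S, ℝ) :=
  ⟨fun x => (x : Eucl p) j, by fun_prop⟩

/-- The functions whose products with all plane waves of low frequency are in the closed span
of the latter. -/
def lowFrequencyMultipliers (S : Set (Eucl p)) [CompactSpace S] : Set C(S, ℝ) :=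
  {g | ∀ (b : Eucl p) (θ : ℝ), ∑ i, |b i| < 1 / 2 → g * planeWaveOn S b θ ∈ lowFrequencySpan S}

variable {S : Set (Eucl p)}

lemma isClosed_lowFrequencyMultipliers [CompactSpace S] : IsClosed (lowFrequencyMultipliers S) := by
  simp only [lowFrequencyMultipliers, ofPred_forall]
  refine isClosed_iInter fun b => isClosed_iInter fun θ => isClosed_iInter fun _ => ?_
  exact (Submodule.isClosed_topologicalClosure _).preimage (continuous_mul_const _)

lemma one_mem_lowFrequencyMultipliers [CompactSpace S] :
    (1 : C(S, ℝ)) ∈ lowFrequencyMultipliers S := by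
  intro b θ hb
  rw [one_mul]
  exact Submodule.le_topologicalClosure _ (Submodule.subset_span ⟨b, θ, hb, rfl⟩)

lemma sum_abs_add_smul_single_le (b : Eucl p) (j : Fin p) (t : ℝ) :
    ∑ i, |(b + t • EuclideanSpace.single j (1 : ℝ)) i| ≤ ∑ i, |b i| + |t| := by
  calc ∑ i, |(b + t • EuclideanSpace.single j (1 : ℝ)) i|
      ≤ ∑ i, (|b i| + if i = j then |t| else 0) := by
        refine Finset.sum_le_sum fun i _ => ?_
        by_cases h : i = j
        · simpa [h] using abs_add_le (b j) t
        · simp [h]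
    _ = ∑ i, |b i| + |t| := by simp [Finset.sum_add_distrib]

/-- The difference quotient of `b ↦ sin (⟨b, x⟩ + θ)` in the direction of the `j`-th coordinate,
extended continuously to `t = 0`. -/
noncomputable def waveQuotient (S : Set (Eucl p)) (b : Eucl p) (θ : ℝ) (j : Fin p) (t : ℝ) :
    C(S, ℝ) :=
  (ContinuousMap.mk (fun q : ℝ × S => (q.2 : Eucl p) j * (Real.sinc (q.1 * (q.2 : Eucl p) j / 2) *
      Real.cos (inner ℝ b (q.2 : Eucl p) + θ + q.1 * (q.2 : Eucl p) j / 2))) (by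
    have : Continuous fun q : ℝ × S => inner ℝ b (q.2 : Eucl p) :=
      continuous_const.inner (continuous_subtype_val.comp continuous_snd)
    have := Real.continuous_sinc
    fun_prop)).curry t

lemma waveQuotient_zero (b : Eucl p) (θ : ℝ) (j : Fin p) :
    waveQuotient S b θ j 0 = coordOn S j * planeWaveOn S b θ := by
  ext x
  simp [waveQuotient, coordOn, planeWaveOn, planeWave]

/-- The identity sin v - sin u = 2 sin((v - u)/2) cos((v + u)/2); the phase shift by π/2 writes the
sines as plane waves. -/
lemma smul_waveQuotient (b : Eucl p) (θ : ℝ) (j : Fin p) (t : ℝ) :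
    t • waveQuotient S b θ j t =
      planeWaveOn S (b + t • EuclideanSpace.single j 1) (θ - Real.pi / 2)
        - planeWaveOn S b (θ - Real.pi / 2) := by
  ext x
  have h1 : inner ℝ (b + t • EuclideanSpace.single j (1 : ℝ)) (x : Eucl p)
      = inner ℝ b (x : Eucl p) + t * (x : Eucl p) j := by
    rw [inner_add_left, inner_smul_left, EuclideanSpace.inner_single_left]
    simp
  simp only [waveQuotient, planeWaveOn, planeWave, ContinuousMap.coe_smul, Pi.smul_apply,
    ContinuousMap.curry_apply, ContinuousMap.coe_mk, ContinuousMap.coe_sub, Pi.sub_apply,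
    smul_eq_mul, one_mul, h1]
  set u := inner ℝ b (x : Eucl p) + θ with hu
  set c := (x : Eucl p) j
  rw [show inner ℝ b (x : Eucl p) + t * c + (θ - Real.pi / 2) = u + t * c - Real.pi / 2 by
      rw [hu]; ring,
    show inner ℝ b (x : Eucl p) + (θ - Real.pi / 2) = u - Real.pi / 2 by rw [hu]; ring,
    Real.cos_sub_pi_div_two, Real.cos_sub_pi_div_two, Real.sin_sub_sin]
  rw [show (u + t * c - u) / 2 = t * c / 2 by ring, show (u + t * c + u) / 2 = u + t * c / 2 by ring]
  by_cases h : t * c / 2 = 0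
  · have h' : t * c = 0 := by linarith
    rw [h, ← mul_assoc, h']
    simp
  · have ht : t ≠ 0 := by rintro rfl; simp at h
    have hc : c ≠ 0 := by intro h0; simp [h0] at h
    rw [Real.sinc_of_ne_zero h]
    field_simp

/-- Differentiating a sine wave in b along the j-th axis brings down the j-th coordinate. The
difference quotients converge uniformly on `S`, and the strict bound on the frequency leaves room to
move b by a small t. -/
lemma coordOn_mul_mem_lowFrequencyMultipliers [CompactSpace S] {g : C(S, ℝ)}
    (hg : g ∈ lowFrequencyMultipliers S)
    (j : Fin p) : coordOn S j * g ∈ lowFrequencyMultipliers S := by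
  intro b θ hb
  have hcont : Continuous fun t => g * waveQuotient S b θ j t :=
    continuous_const.mul (ContinuousMap.continuous _)
  have h0 : coordOn S j * g * planeWaveOn S b θ = g * waveQuotient S b θ j 0 := by
    rw [waveQuotient_zero]; ring
  rw [h0]
  refine (Submodule.isClosed_topologicalClosure _).mem_of_tendsto
    ((hcont.tendsto 0).mono_left nhdsWithin_le_nhds : Tendsto _ (𝓝[≠] (0 : ℝ)) _) ?_
  have hnear : ∀ᶠ t : ℝ in 𝓝 0, |t| < 1 / 2 - ∑ i, |b i| := by
    have : Tendsto (fun t : ℝ => |t|) (𝓝 0) (𝓝 |0|) := continuous_abs.tendsto 0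
    exact this.eventually_lt_const (by rw [abs_zero]; linarith)
  filter_upwards [hnear.filter_mono nhdsWithin_le_nhds, self_mem_nhdsWithin] with t ht ht0
  have hsm := smul_waveQuotient (S := S) b θ j t
  have : g * waveQuotient S b θ j t = t⁻¹ • (g * planeWaveOn S (b + t • EuclideanSpace.single j 1)
      (θ - Real.pi / 2) - g * planeWaveOn S b (θ - Real.pi / 2)) := by
    rw [← mul_sub, ← hsm, mul_smul_comm, smul_smul, inv_mul_cancel₀ ht0, one_smul]
  rw [this]
  refine Submodule.smul_mem _ _ (Submodule.sub_mem _ (hg _ _ ?_) (hg _ _ hb))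
  linarith [sum_abs_add_smul_single_le b j t]

/-- Plane waves of low frequency span a dense subspace of the continuous functions on a
compact set. -/
lemma lowFrequencySpan_eq_top [CompactSpace S] : lowFrequencySpan S = ⊤ := by
  let W := lowFrequencyMultipliers S
  have hadd : ∀ {f g}, f ∈ W → g ∈ W → f + g ∈ W := fun {f g} hf hg b θ hb => by
    rw [add_mul]
    exact Submodule.add_mem _ (hf b θ hb) (hg b θ hb)
  have hsmul : ∀ (c : ℝ) {f}, f ∈ W → c • f ∈ W := fun c {f} hf b θ hb => by
    rw [smul_mul_assoc]
    exact Submodule.smul_mem _ _ (hf b θ hb)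
  -- `W` itself is not visibly closed under products; the functions mapping `W` into itself form an
  -- algebra, to which Stone–Weierstrass applies.
  let A : Subalgebra ℝ C(S, ℝ) :=
    { carrier := {m | ∀ g ∈ W, m * g ∈ W}
      mul_mem' := fun {m n} hm hn g hg => by rw [mul_assoc]; exact hm _ (hn g hg)
      add_mem' := fun {m n} hm hn g hg => by rw [add_mul]; exact hadd (hm g hg) (hn g hg)
      algebraMap_mem' := fun c g hg => by
        rw [← Algebra.smul_def]; exact hsmul c hg }
  have hA : IsClosed (A : Set C(S, ℝ)) := by
    change IsClosed {m | ∀ g ∈ W, m * g ∈ W}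
    simp only [ofPred_forall]
    exact isClosed_iInter fun g => isClosed_iInter fun _ =>
      isClosed_lowFrequencyMultipliers.preimage (continuous_mul_const _)
  have hsep : A.SeparatesPoints := by
    intro x y hxy
    obtain ⟨j, hj⟩ : ∃ j, (x : Eucl p) j ≠ (y : Eucl p) j := by
      by_contra! h
      exact hxy (Subtype.ext (PiLp.ext h))
    exact ⟨coordOn S j, ⟨coordOn S j,
      fun g hg => coordOn_mul_mem_lowFrequencyMultipliers hg j, rfl⟩, hj⟩
  have htop := ContinuousMap.subalgebra_topologicalClosure_eq_top_of_separatesPoints A hsep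
  refine eq_top_iff.2 fun m _ => ?_
  have hm : m ∈ A := by
    have : m ∈ A.topologicalClosure := htop ▸ Algebra.mem_top
    rwa [← SetLike.mem_coe, Subalgebra.topologicalClosure_coe, hA.closure_eq] at this
  -- The wave with b = 0 and zero phase is the constant 1, so membership of m · 1 in `W` puts m in
  -- the closed span.
  have h1 := hm 1 one_mem_lowFrequencyMultipliers 0 (Real.pi / 2 - Real.pi / 2) (by simp)
  have h2 : m * 1 * planeWaveOn S 0 (Real.pi / 2 - Real.pi / 2) = m := by
    ext x
    simp [planeWaveOn, planeWave]
  rwa [h2] at h1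

end Approximation

/-! ### Control of a fixed test function, uniformly in the order -/

/-- The integrals of translates of a fixed continuous function against measures with supports in a
fixed ball are controlled by the Hölder integral probability metrics, uniformly in the order. -/
lemma exists_abs_integral_sub_le {p : ℕ} {h : Eucl p → ℝ} (hc : Continuous h) {B : ℝ}
    (hB : ∀ x, |h x| ≤ B) (R : ℝ) {ε : ℝ} (hε : 0 < ε) :
    ∃ A : ℝ, 0 ≤ A ∧ ∀ (η : ℝ) (μ ν : Measure (Eucl p)) [IsProbabilityMeasure μ]
      [IsProbabilityMeasure ν] (x₀ : Eucl p), 0 ≤ η → (∀ᵐ x ∂μ, x ∈ Metric.closedBall x₀ R) →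
      (∀ᵐ x ∂ν, x ∈ Metric.closedBall x₀ R) →
      |∫ x, h (x - x₀) ∂μ - ∫ x, h (x - x₀) ∂ν| ≤ A * holderIPM η μ ν + ε := by
  let S : Set (Eucl p) := Metric.closedBall 0 R
  have : CompactSpace S := isCompact_iff_compactSpace.1 (isCompact_closedBall 0 R)
  let hS : C(S, ℝ) := ⟨fun x => h x, hc.comp continuous_subtype_val⟩
  have hmem : hS ∈ closure (Submodule.span ℝ {g : C(S, ℝ) | ∃ (b : Eucl p) (θ : ℝ),
      ∑ i, |b i| < 1 / 2 ∧ g = planeWaveOn S b θ} : Set C(S, ℝ)) := by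
    have : hS ∈ lowFrequencySpan S := lowFrequencySpan_eq_top (S := S) ▸ Submodule.mem_top
    exact this
  obtain ⟨g, hg, hdist⟩ := Metric.mem_closure_iff.1 hmem (ε / 2) (half_pos hε)
  -- The element of the span is extended to a bounded continuous function on the whole space, so
  -- that it can be translated and integrated.
  have hP : ∃ G : Eucl p → ℝ, Continuous G ∧ (∃ B, ∀ x, |G x| ≤ B) ∧ (∀ x : S, G x = g x) ∧
      ∃ A : ℝ, 0 ≤ A ∧ ∀ (η : ℝ) (μ ν : Measure (Eucl p)) [IsProbabilityMeasure μ]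
      [IsProbabilityMeasure ν] (x₀ : Eucl p), 0 ≤ η →
      |∫ x, G (x - x₀) ∂μ - ∫ x, G (x - x₀) ∂ν| ≤ A * holderIPM η μ ν := by
    have hint : ∀ (μ : Measure (Eucl p)) [IsProbabilityMeasure μ] (G : Eucl p → ℝ) (B : ℝ)
        (x₀ : Eucl p), Continuous G → (∀ x, |G x| ≤ B) → Integrable (fun x => G (x - x₀)) μ :=
      fun μ _ G B x₀ hG hB => Integrable.of_bound (by fun_prop) B
        (Eventually.of_forall fun x => hB _)
    clear hdist
    induction hg using Submodule.span_induction with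
    | mem g hg =>
      obtain ⟨b, θ, hb, rfl⟩ := hg
      refine ⟨planeWave 1 b θ, continuous_planeWave 1 b θ, ⟨|1|, abs_planeWave_le 1 b θ⟩,
        fun x => rfl, 4, by norm_num, fun η μ ν _ _ x₀ hη => ?_⟩
      have : ∀ x, planeWave 1 b θ (x - x₀) = planeWave 1 b (θ - inner ℝ b x₀) x := by
        intro x
        rw [planeWave, planeWave, inner_sub_right]
        congr 2
        ring
      simp_rw [this]
      exact abs_integral_planeWave_sub_le μ ν hη hb.le _
    | zero => exact ⟨0, continuous_const, ⟨0, by simp⟩, by simp, 0, le_rfl, by simp⟩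
    | add g₁ g₂ _ _ ih₁ ih₂ =>
      obtain ⟨G₁, hc₁, ⟨B₁, hB₁⟩, he₁, A₁, hA₁, h₁⟩ := ih₁
      obtain ⟨G₂, hc₂, ⟨B₂, hB₂⟩, he₂, A₂, hA₂, h₂⟩ := ih₂
      refine ⟨fun x => G₁ x + G₂ x, hc₁.add hc₂, ⟨B₁ + B₂, fun x => (abs_add_le _ _).trans
        (add_le_add (hB₁ x) (hB₂ x))⟩, fun x => by simp [he₁, he₂], A₁ + A₂, add_nonneg hA₁ hA₂,
        fun η μ ν _ _ x₀ hη => ?_⟩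
      rw [integral_add (hint μ G₁ B₁ x₀ hc₁ hB₁) (hint μ G₂ B₂ x₀ hc₂ hB₂),
        integral_add (hint ν G₁ B₁ x₀ hc₁ hB₁) (hint ν G₂ B₂ x₀ hc₂ hB₂), add_sub_add_comm, add_mul]
      exact (abs_add_le _ _).trans (add_le_add (h₁ η μ ν x₀ hη) (h₂ η μ ν x₀ hη))
    | smul c g _ ih =>
      obtain ⟨G, hc, ⟨B, hB⟩, he, A, hA, h⟩ := ih
      refine ⟨fun x => c * G x, hc.const_mul c, ⟨|c| * B, fun x => ?_⟩, fun x => by simp [he],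
        |c| * A, by positivity, fun η μ ν _ _ x₀ hη => ?_⟩
      · rw [abs_mul]
        exact mul_le_mul_of_nonneg_left (hB x) (abs_nonneg c)
      · rw [integral_const_mul, integral_const_mul, ← mul_sub, abs_mul, mul_assoc]
        exact mul_le_mul_of_nonneg_left (h η μ ν x₀ hη) (abs_nonneg c)
  obtain ⟨G, hGc, ⟨B', hB'⟩, hGe, A, hA, hG⟩ := hP
  refine ⟨A, hA, fun η μ ν _ _ x₀ hη hμ hν => ?_⟩
  have hclose : ∀ (ρ : Measure (Eucl p)) [IsProbabilityMeasure ρ],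
      (∀ᵐ x ∂ρ, x ∈ Metric.closedBall x₀ R) →
      |∫ x, h (x - x₀) ∂ρ - ∫ x, G (x - x₀) ∂ρ| ≤ ε / 2 := by
    intro ρ _ hρ
    rw [← integral_sub (Integrable.of_bound (by fun_prop) B (Eventually.of_forall fun x => hB _))
      (Integrable.of_bound (by fun_prop) B' (Eventually.of_forall fun x => hB' _))]
    have := norm_integral_le_of_norm_le_const (μ := ρ) (C := ε / 2)
      (f := fun x => h (x - x₀) - G (x - x₀)) (by
        filter_upwards [hρ] with x hx
        have hx' : x - x₀ ∈ S := by simpa [S, dist_eq_norm] using hx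
        have h1 := ContinuousMap.dist_apply_le_dist (f := hS) (g := g) ⟨x - x₀, hx'⟩
        rw [← hGe, Real.dist_eq] at h1
        exact h1.trans hdist.le)
    simpa using this
  have h1 := abs_le.1 (hclose μ hμ)
  have h2 := abs_le.1 (hclose ν hν)
  have h3 := abs_le.1 (hG η μ ν x₀ hη)
  rw [abs_le]
  constructor <;> linarith

/-! ### Lipschitz bounds and chart constants -/

lemma InHolderBall.differentiableAt {n : ℕ} {η K : ℝ} {X : Set (Eucl n)} {g : Eucl n → ℝ}
    (hη : 1 ≤ η) (hX : IsOpen X) (hg : InHolderBall η K X g) {x : Eucl n} (hx : x ∈ X) :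
    DifferentiableAt ℝ g x := by
  have h1 : (1 : ℕ) ≤ ⌊η⌋₊ := Nat.le_floor (by simpa using hη)
  refine (hg.1.differentiableOn ?_).differentiableAt (hX.mem_nhds hx)
  exact_mod_cast (by omega : ⌊η⌋₊ ≠ 0)

lemma InHolderBall.norm_fderiv_le {n : ℕ} {η K : ℝ} {X : Set (Eucl n)} {g : Eucl n → ℝ}
    (hη : 1 ≤ η) (hK : 0 ≤ K) (hX : IsOpen X) (hg : InHolderBall η K X g) {x : Eucl n}
    (hx : x ∈ X) : ‖fderiv ℝ g x‖ ≤ n * K := by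
  refine ContinuousLinearMap.opNorm_le_bound _ (by positivity) fun v => ?_
  have hv : fderiv ℝ g x v = ∑ i, v i * partialDeriv i g x := by
    conv_lhs => rw [← (EuclideanSpace.basisFun (Fin n) ℝ).sum_repr v, map_sum]
    refine Finset.sum_congr rfl fun i _ => ?_
    rw [map_smul, partialDeriv, (hg.differentiableAt hη hX hx).lineDeriv_eq_fderiv]
    simp
  rw [hv]
  refine (norm_sum_le _ _).trans ?_
  calc ∑ i, ‖v i * partialDeriv i g x‖ ≤ ∑ _i : Fin n, ‖v‖ * K := by
        refine Finset.sum_le_sum fun i _ => ?_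
        rw [norm_mul]
        exact mul_le_mul (PiLp.norm_apply_le v i) (hg.abs_partialDeriv_le hK hη i hx)
          (norm_nonneg _) (norm_nonneg _)
    _ = n * K * ‖v‖ := by simp; ring

lemma InHolderBall.abs_sub_le_of_convex {n : ℕ} {η K : ℝ} {X : Set (Eucl n)} {g : Eucl n → ℝ}
    (hη : 1 ≤ η) (hK : 0 ≤ K) (hX : IsOpen X) (hg : InHolderBall η K X g) {s : Set (Eucl n)}
    (hs : Convex ℝ s) (hsX : s ⊆ X) {u v : Eucl n} (hu : u ∈ s) (hv : v ∈ s) :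
    |g u - g v| ≤ n * K * ‖u - v‖ :=
  hs.norm_image_sub_le_of_norm_fderiv_le (𝕜 := ℝ)
    (fun _ hx => hg.differentiableAt hη hX (hsX hx))
    (fun _ hx => hg.norm_fderiv_le hη hK hX (hsX hx)) hv hu

/-- A Lipschitz constant of the inverse charts of a manifold satisfying `ManifoldCondition`. -/
def chartLip (p d : ℕ) (K : ℝ) : ℝ := p * (d * K)

lemma InHolderBallVec.norm_sub_le_of_convex {n m : ℕ} {η K : ℝ} {X : Set (Eucl n)}
    {g : Eucl n → Eucl m} (hη : 1 ≤ η) (hK : 0 ≤ K) (hX : IsOpen X) (hg : InHolderBallVec η K X g)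
    {s : Set (Eucl n)} (hs : Convex ℝ s) (hsX : s ⊆ X) {u v : Eucl n} (hu : u ∈ s) (hv : v ∈ s) :
    ‖g u - g v‖ ≤ chartLip m n K * ‖u - v‖ := by
  refine (norm_le_sum_abs _).trans ?_
  calc ∑ i, |(g u - g v) i| ≤ ∑ _i : Fin m, n * K * ‖u - v‖ :=
        Finset.sum_le_sum fun i _ => (hg i).abs_sub_le_of_convex hη hK hX hs hsX hu hv
    _ = chartLip m n K * ‖u - v‖ := by simp [chartLip]; ring

lemma one_le_chartLip {p d : ℕ} {K : ℝ} (hd : 1 ≤ d) (hp : 1 ≤ p) (hK : 1 ≤ K) :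
    1 ≤ chartLip p d K := by
  have h1 : (1 : ℝ) ≤ d := by exact_mod_cast hd
  have h2 : (1 : ℝ) ≤ p := by exact_mod_cast hp
  exact one_le_mul_of_one_le_of_one_le h2 (one_le_mul_of_one_le_of_one_le h1 hK)

/-- A radius on which the charts of a manifold satisfying `ManifoldCondition` are controlled. -/
noncomputable def chartRadius (p d : ℕ) (K : ℝ) : ℝ := (2 * K * chartLip p d K)⁻¹

lemma chartRadius_pos {p d : ℕ} {K : ℝ} (hd : 1 ≤ d) (hp : 1 ≤ p) (hK : 1 ≤ K) :
    0 < chartRadius p d K := by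
  have := one_le_chartLip hd hp hK
  unfold chartRadius
  positivity

lemma chartLip_mul_chartRadius_lt {p d : ℕ} {K : ℝ} (hd : 1 ≤ d) (hp : 1 ≤ p) (hK : 1 ≤ K) :
    chartLip p d K * chartRadius p d K < K⁻¹ := by
  have h := one_le_chartLip hd hp hK
  have hK' : 0 < K := by linarith
  have : chartLip p d K * chartRadius p d K = K⁻¹ / 2 := by
    unfold chartRadius
    field_simp
  rw [this]
  exact half_lt_self (inv_pos.2 hK')

lemma chartRadius_lt {p d : ℕ} {K : ℝ} (hd : 1 ≤ d) (hp : 1 ≤ p) (hK : 1 ≤ K) :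
    chartRadius p d K < K⁻¹ :=
  lt_of_le_of_lt (le_mul_of_one_le_left (chartRadius_pos hd hp hK).le (one_le_chartLip hd hp hK))
    (chartLip_mul_chartRadius_lt hd hp hK)

/-! ### Charts on balls of controlled radius -/

section Chart

variable {p d : ℕ} {s K : ℝ} {M : Set (Eucl p)} {x : Eucl p}
  (b : OrthonormalBasis (Fin d) ℝ (tangentSpaceAt M x))

lemma norm_chart_sub_le (z w : Eucl p) : ‖chart M x b z - chart M x b w‖ ≤ ‖z - w‖ := by
  rw [chart, chart, ← map_sub, LinearIsometryEquiv.norm_map, ← map_sub, sub_sub_sub_cancel_right]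
  exact (tangentSpaceAt M x).norm_orthogonalProjectionOnto_apply_le _

lemma lipschitzWith_chart : LipschitzWith 1 (chart M x b) :=
  LipschitzWith.of_dist_le_mul fun z w => by
    simpa [dist_eq_norm] using norm_chart_sub_le b z w

lemma chart_self : chart M x b x = 0 := by simp [chart]

lemma mem_chartDomain_self (hK : 0 < K) (hx : x ∈ M) : x ∈ chartDomain K M x :=
  ⟨Metric.mem_ball_self (inv_pos.2 hK), hx⟩

variable {b} in
lemma chartInv_mem {u : Eucl d} (hu : u ∈ chart M x b '' chartDomain K M x) :
    chartInv K M x b u ∈ chartDomain K M x :=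
  Function.invFunOn_mem hu

variable {b} in
lemma chart_chartInv {u : Eucl d} (hu : u ∈ chart M x b '' chartDomain K M x) :
    chart M x b (chartInv K M x b u) = u :=
  Function.invFunOn_eq hu

variable {b} in
lemma chartInv_chart (h : InjOn (chart M x b) (chartDomain K M x)) {z : Eucl p}
    (hz : z ∈ chartDomain K M x) : chartInv K M x b (chart M x b z) = z :=
  h.leftInvOn_invFunOn hz

lemma chart_eq_chart_iff (b' : OrthonormalBasis (Fin d) ℝ (tangentSpaceAt M x)) {z w : Eucl p} :
    chart M x b z = chart M x b w ↔ chart M x b' z = chart M x b' w := by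
  simp [chart]

/-- The manifold condition and the Hölder condition on a density each provide their own basis. Two
bases differ by a linear isometry, so injectivity and openness of the image pass from one to the
other. -/
lemma chart_change (b' : OrthonormalBasis (Fin d) ℝ (tangentSpaceAt M x)) (z : Eucl p) :
    chart M x b' z = b'.repr (b.repr.symm (chart M x b z)) := by
  simp [chart]

/-- The image of a chart contains a ball of controlled radius. -/
lemma ball_subset_image_chart_of_inHolderBallVec (hd : 1 ≤ d) (hp : 1 ≤ p) (hK : 1 ≤ K)
    (hs : 1 ≤ s) (hM : IsCompact M) (hx : x ∈ M)
    (hinj : InjOn (chart M x b) (chartDomain K M x))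
    (hopen : IsOpen (chart M x b '' chartDomain K M x))
    (hreg : InHolderBallVec s K (chart M x b '' chartDomain K M x) (chartInv K M x b)) :
    Metric.ball 0 (chartRadius p d K) ⊆ chart M x b '' chartDomain K M x := by
  set Ω := chart M x b '' chartDomain K M x with hΩ
  have hK0 : 0 < K := by linarith
  have hL := one_le_chartLip hd hp hK
  have h0 : (0 : Eucl d) ∈ Ω := ⟨x, mem_chartDomain_self hK0 hx, chart_self b⟩
  by_contra hnot
  obtain ⟨w₀, hw₀, hw₀Ω⟩ := not_subset.1 hnot
  -- Take a point `w` of the complement nearest to 0. The open ball up to `w` lies in the image and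
  -- is convex, so the inverse chart is Lipschitz on it.
  obtain ⟨w, hwΩ, hw⟩ := hopen.isClosed_compl.exists_infDist_eq_dist ⟨w₀, hw₀Ω⟩ (0 : Eucl d)
  set ρ := dist (0 : Eucl d) w with hρ
  have hρ0 : 0 < ρ := dist_pos.2 fun h => hwΩ (h ▸ h0)
  have hρr : ρ < chartRadius p d K := by
    rw [← hw]
    refine (Metric.infDist_le_dist_of_mem hw₀Ω).trans_lt ?_
    rwa [dist_comm]
  have hball : Metric.ball 0 ρ ⊆ Ω := by
    intro u hu
    by_contra huΩ
    have := Metric.infDist_le_dist_of_mem (x := (0 : Eucl d)) (show u ∈ Ωᶜ from huΩ)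
    rw [hw, dist_comm] at this
    exact absurd (Metric.mem_ball.1 hu) (not_lt.2 this)
  have hψ0 : chartInv K M x b 0 = x := by
    rw [← chart_self b]
    exact chartInv_chart hinj (mem_chartDomain_self hK0 hx)
  have hcomp : IsCompact (M ∩ Metric.closedBall x (chartLip p d K * ρ)) :=
    hM.inter_right Metric.isClosed_closedBall
  have hwcl : w ∈ closure (Metric.ball (0 : Eucl d) ρ) := by
    rw [closure_ball _ hρ0.ne', Metric.mem_closedBall, dist_comm]
  have hne : (𝓝[Metric.ball (0 : Eucl d) ρ] w).NeBot := mem_closure_iff_nhdsWithin_neBot.1 hwcl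
  have hle : map (chartInv K M x b) (𝓝[Metric.ball (0 : Eucl d) ρ] w) ≤
      𝓟 (M ∩ Metric.closedBall x (chartLip p d K * ρ)) := by
    refine le_principal_iff.2 (mem_map.2 ?_)
    filter_upwards [self_mem_nhdsWithin] with u hu
    refine ⟨(chartInv_mem (hball hu)).2, ?_⟩
    have h1 := hreg.norm_sub_le_of_convex hs hK0.le hopen (convex_ball 0 ρ) hball hu
      (Metric.mem_ball_self hρ0)
    rw [hψ0, sub_zero] at h1
    rw [Metric.mem_closedBall, dist_eq_norm]
    refine h1.trans ?_
    gcongr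
    simpa using (Metric.mem_ball.1 hu).le
  -- As u tends to `w`, the points of `M` over u stay in a compact set inside the chart domain. A
  -- cluster point `y` lies over `w`, contradicting the choice of `w`.
  obtain ⟨y, ⟨hyM, hyx⟩, hy⟩ := hcomp hle
  have hlim : Tendsto (chart M x b) (map (chartInv K M x b) (𝓝[Metric.ball (0 : Eucl d) ρ] w))
      (𝓝 w) := by
    rw [tendsto_map'_iff]
    refine Tendsto.congr' (f₁ := id) ?_ (tendsto_id.mono_left nhdsWithin_le_nhds)
    filter_upwards [self_mem_nhdsWithin] with u hu
    exact (chart_chartInv (hball hu)).symm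
  have hyw : chart M x b y = w := by
    have h1 : ClusterPt (chart M x b y) (𝓝 w) :=
      (hy.map (lipschitzWith_chart b).continuous.continuousAt tendsto_map).mono hlim
    exact eq_of_nhds_neBot h1
  refine hwΩ ⟨y, ⟨?_, hyM⟩, hyw⟩
  rw [Metric.mem_ball]
  refine (Metric.mem_closedBall.1 hyx).trans_lt (lt_trans ?_ (chartLip_mul_chartRadius_lt hd hp hK))
  gcongr

lemma ManifoldCondition.injOn_chart (hM : ManifoldCondition d s K M) (hx : x ∈ M) :
    InjOn (chart M x b) (chartDomain K M x) := by
  obtain ⟨b', hinj, -⟩ := hM.chart_regular x hx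
  exact fun z hz w hw h => hinj hz hw ((chart_eq_chart_iff b b').1 h)

lemma ManifoldCondition.isOpen_image_chart (hM : ManifoldCondition d s K M) (hx : x ∈ M) :
    IsOpen (chart M x b '' chartDomain K M x) := by
  obtain ⟨b', -, hopen, -⟩ := hM.chart_regular x hx
  have : chart M x b '' chartDomain K M x =
      (b'.repr.symm.trans b.repr).toHomeomorph '' (chart M x b' '' chartDomain K M x) := by
    rw [image_image]
    exact image_congr fun z _ => chart_change b' b z
  rw [this]
  exact (Homeomorph.isOpenMap _) _ hopen

lemma ManifoldCondition.ball_subset_image_chart (hd : 1 ≤ d) (hp : 1 ≤ p) (hK : 1 ≤ K)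
    (hs : 1 ≤ s) (hM : ManifoldCondition d s K M) (hx : x ∈ M) :
    Metric.ball 0 (chartRadius p d K) ⊆ chart M x b '' chartDomain K M x := by
  obtain ⟨b', hinj, hopen, -, hreg⟩ := hM.chart_regular x hx
  intro u hu
  obtain ⟨z, hz, hzu⟩ := ball_subset_image_chart_of_inHolderBallVec b' hd hp hK hs
    hM.closedSubmanifold.1 hx hinj hopen hreg
    (show b'.repr (b.repr.symm u) ∈ Metric.ball 0 (chartRadius p d K) by simpa using hu)
  exact ⟨z, hz, by rw [chart_change b' b, hzu]; simp⟩

end Chart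

/-- Around each of its points, a manifold satisfying `ManifoldCondition` is parametrised by a
Lipschitz map on a ball of controlled radius, with a `1`-Lipschitz inverse. -/
lemma ManifoldCondition.exists_local_chart {p d : ℕ} {s K : ℝ} {M : Set (Eucl p)} {x : Eucl p}
    (hd : 1 ≤ d) (hp : 1 ≤ p) (hK : 1 ≤ K) (hs : 1 ≤ s) (hM : ManifoldCondition d s K M)
    (hx : x ∈ M) :
    ∃ (φ : Eucl p → Eucl d) (ψ : Eucl d → Eucl p), LipschitzWith 1 φ ∧ φ x = 0 ∧
      (∀ u ∈ Metric.ball (0 : Eucl d) (chartRadius p d K), ψ u ∈ M ∧ φ (ψ u) = u) ∧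
      (∀ z ∈ Metric.ball x (chartRadius p d K) ∩ M, ψ (φ z) = z) ∧
      ∀ u ∈ Metric.ball (0 : Eucl d) (chartRadius p d K),
        ∀ v ∈ Metric.ball (0 : Eucl d) (chartRadius p d K),
        dist (ψ u) (ψ v) ≤ chartLip p d K * dist u v := by
  obtain ⟨b, hinj, hopen, -, hreg⟩ := hM.chart_regular x hx
  have hsub := hM.ball_subset_image_chart b hd hp hK hs hx
  refine ⟨chart M x b, chartInv K M x b, lipschitzWith_chart b, chart_self b,
    fun u hu => ⟨(chartInv_mem (hsub hu)).2, chart_chartInv (hsub hu)⟩,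
    fun z hz => chartInv_chart hinj
      ⟨Metric.ball_subset_ball (chartRadius_lt hd hp hK).le hz.1, hz.2⟩, fun u hu v hv => ?_⟩
  rw [dist_eq_norm, dist_eq_norm]
  exact hreg.norm_sub_le_of_convex hs (by linarith) hopen (convex_ball _ _) hsub hu hv

lemma InHolderBallManifold.abs_sub_le {p d : ℕ} {s s' K : ℝ} {M : Set (Eucl p)} {x z : Eucl p}
    {f : Eucl p → ℝ} (hd : 1 ≤ d) (hp : 1 ≤ p) (hK : 1 ≤ K) (hs : 1 ≤ s) (hs' : 1 ≤ s')
    (hM : ManifoldCondition d s K M) (hf : InHolderBallManifold d s' K M f) (hx : x ∈ M)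
    (hz : z ∈ M) (hzx : dist z x < chartRadius p d K) :
    |f z - f x| ≤ d * K * dist z x := by
  obtain ⟨b, hb⟩ := hf x hx
  have hK0 : 0 < K := by linarith
  have hsub := hM.ball_subset_image_chart b hd hp hK hs hx
  have hinj := hM.injOn_chart b hx
  have hn : ‖chart M x b z‖ ≤ dist z x := by
    simpa [chart_self, dist_eq_norm] using norm_chart_sub_le b z x
  have h := hb.abs_sub_le_of_convex hs' hK0.le (hM.isOpen_image_chart b hx) (convex_ball _ _) hsub
    (u := chart M x b z) (v := chart M x b x)
    (by simpa using hn.trans_lt hzx) (by simpa [chart_self] using chartRadius_pos hd hp hK)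
  rw [chartInv_chart hinj (mem_chartDomain_self hK0 hx), chartInv_chart hinj
    ⟨hzx.trans (chartRadius_lt hd hp hK), hz⟩, chart_self, sub_zero] at h
  exact h.trans (by gcongr)

lemma InHolderBallManifold.continuousOn {p d : ℕ} {s s' K : ℝ} {M : Set (Eucl p)}
    {f : Eucl p → ℝ} (hd : 1 ≤ d) (hp : 1 ≤ p) (hK : 1 ≤ K) (hs : 1 ≤ s) (hs' : 1 ≤ s')
    (hM : ManifoldCondition d s K M) (hf : InHolderBallManifold d s' K M f) :
    ContinuousOn f M := by
  intro x hx
  rw [ContinuousWithinAt, tendsto_iff_dist_tendsto_zero]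
  have hlim : Tendsto (fun z => d * K * dist z x) (𝓝[M] x) (𝓝 0) := by
    have : Continuous fun z : Eucl p => d * K * dist z x := by fun_prop
    simpa using (this.tendsto x).mono_left nhdsWithin_le_nhds
  refine squeeze_zero' (Eventually.of_forall fun _ => dist_nonneg) ?_ hlim
  filter_upwards [self_mem_nhdsWithin, nhdsWithin_le_nhds
    (Metric.ball_mem_nhds x (chartRadius_pos hd hp hK))] with z hz hzx
  exact hf.abs_sub_le hd hp hK hs hs' hM hx hz hzx

/-! ### Volumes of balls and masses of densities -/

lemma euclideanHausdorffMeasure_image_le {X Y : Type*} [MetricSpace X] [MeasurableSpace X]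
    [BorelSpace X] [MetricSpace Y] [MeasurableSpace Y] [BorelSpace Y] {f : X → Y} {s : Set X}
    {C : NNReal} (h : LipschitzOnWith C f s) (d : ℕ) :
    Measure.euclideanHausdorffMeasure d (f '' s) ≤
      (C : ℝ≥0∞) ^ d * Measure.euclideanHausdorffMeasure d s := by
  simp_rw [Measure.euclideanHausdorffMeasure_def, Measure.smul_apply, ENNReal.smul_def, smul_eq_mul]
  rw [mul_left_comm]
  gcongr
  simpa using h.hausdorffMeasure_image_le (Nat.cast_nonneg d)

/-- The volume of the unit ball of `ℝ^d`. -/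
noncomputable def unitBallVolume (d : ℕ) : ℝ := volume.real (Metric.ball (0 : Eucl d) 1)

lemma unitBallVolume_pos (d : ℕ) : 0 < unitBallVolume d :=
  ENNReal.toReal_pos (Metric.measure_ball_pos _ _ one_pos).ne' measure_ball_lt_top.ne

lemma euclideanHausdorffMeasure_ball {d : ℕ} {r : ℝ} (hr : 0 < r) :
    Measure.euclideanHausdorffMeasure d (Metric.ball (0 : Eucl d) r) =
      ENNReal.ofReal (r ^ d * unitBallVolume d) := by
  rw [EuclideanSpace.euclideanHausdorffMeasure_eq_volume, Measure.addHaar_ball_of_pos _ _ hr,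
    ENNReal.ofReal_mul (by positivity), finrank_euclideanSpace_fin,
    unitBallVolume, measureReal_def, ENNReal.ofReal_toReal measure_ball_lt_top.ne]

section

variable {p d : ℕ} {s K : ℝ} {M : Set (Eucl p)} {x : Eucl p}

/-- The chart does not increase distances, so the piece of `M` lies in the image, under the
Lipschitz inverse chart, of the Euclidean ball of the same radius. -/
lemma ManifoldCondition.volumeOn_ball_le (hd : 1 ≤ d) (hp : 1 ≤ p) (hK : 1 ≤ K) (hs : 1 ≤ s)
    (hM : ManifoldCondition d s K M) (hx : x ∈ M) {r : ℝ} (hr : 0 < r)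
    (hr' : r ≤ chartRadius p d K) :
    volumeOn d M (Metric.ball x r) ≤
      ENNReal.ofReal (chartLip p d K ^ d * (r ^ d * unitBallVolume d)) := by
  obtain ⟨φ, ψ, hφ, hφx, hψ, hψφ, hlip⟩ := hM.exists_local_chart hd hp hK hs hx
  have hL : 0 ≤ chartLip p d K := by linarith [one_le_chartLip hd hp hK]
  have hsub : Metric.ball x r ∩ M ⊆ ψ '' Metric.ball 0 r := by
    rintro z ⟨hz, hzM⟩
    refine ⟨φ z, ?_, hψφ z ⟨Metric.ball_subset_ball hr' hz, hzM⟩⟩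
    rw [Metric.mem_ball, ← hφx]
    exact (hφ.dist_le_mul z x).trans_lt (by simpa using hz)
  have hlip' : LipschitzOnWith (chartLip p d K).toNNReal ψ (Metric.ball 0 r) :=
    LipschitzOnWith.of_dist_le_mul fun u hu v hv => by
      rw [Real.coe_toNNReal _ hL]
      exact hlip u (Metric.ball_subset_ball hr' hu) v (Metric.ball_subset_ball hr' hv)
  rw [volumeOn, Measure.restrict_apply measurableSet_ball]
  refine (measure_mono hsub).trans ((euclideanHausdorffMeasure_image_le hlip' d).trans_eq ?_)
  rw [euclideanHausdorffMeasure_ball hr, ENNReal.ofReal_mul (pow_nonneg hL d),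
    ENNReal.ofReal_pow hL]
  rfl

/-- The 1-Lipschitz chart maps the piece of `M` onto a set containing the Euclidean ball of radius r
/ `chartLip`. -/
lemma ManifoldCondition.le_volumeOn_ball (hd : 1 ≤ d) (hp : 1 ≤ p) (hK : 1 ≤ K) (hs : 1 ≤ s)
    (hM : ManifoldCondition d s K M) (hx : x ∈ M) {r : ℝ} (hr : 0 < r)
    (hr' : r ≤ chartRadius p d K) :
    ENNReal.ofReal ((r / chartLip p d K) ^ d * unitBallVolume d) ≤
      volumeOn d M (Metric.ball x r) := by
  obtain ⟨φ, ψ, hφ, hφx, hψ, hψφ, hlip⟩ := hM.exists_local_chart hd hp hK hs hx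
  have hL := one_le_chartLip hd hp hK
  have hr0 := chartRadius_pos hd hp hK
  have hrL : r / chartLip p d K ≤ chartRadius p d K := (div_le_self hr.le hL).trans hr'
  have hψ0 : ψ 0 = x := by
    rw [← hφx]
    exact hψφ x ⟨Metric.mem_ball_self hr0, hx⟩
  have hsub : Metric.ball 0 (r / chartLip p d K) ⊆ φ '' (Metric.ball x r ∩ M) := by
    intro u hu
    have hu' := Metric.ball_subset_ball hrL hu
    refine ⟨ψ u, ⟨?_, (hψ u hu').1⟩, (hψ u hu').2⟩
    rw [Metric.mem_ball, lt_div_iff₀ (by linarith)] at hu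
    rw [Metric.mem_ball, ← hψ0]
    refine (hlip u hu' 0 (Metric.mem_ball_self hr0)).trans_lt ?_
    rwa [mul_comm]
  rw [volumeOn, Measure.restrict_apply measurableSet_ball,
    ← euclideanHausdorffMeasure_ball (by positivity)]
  refine (measure_mono hsub).trans
    ((euclideanHausdorffMeasure_image_le hφ.lipschitzOnWith d).trans_eq ?_)
  simp

/-- The manifolds satisfying `ManifoldCondition` have uniformly bounded volumes. -/
lemma exists_volumeOn_univ_le (hd : 1 ≤ d) (hp : 1 ≤ p) (hK : 1 ≤ K) (hs : 1 ≤ s) :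
    ∃ V : ℝ, 0 < V ∧ ∀ M : Set (Eucl p), ManifoldCondition d s K M →
      volumeOn d M univ ≤ ENNReal.ofReal V := by
  have hr0 := chartRadius_pos hd hp hK
  have hL := one_le_chartLip hd hp hK
  set r := chartRadius p d K
  -- The cover is of the ambient ball, so its cardinality does not depend on `M`. Radius r / 2 lets
  -- each ball that meets `M` be recentred at a point of `M` with radius r.
  obtain ⟨t, -, htfin, hcov⟩ :=
    (isCompact_closedBall (0 : Eucl p) K).finite_cover_balls (half_pos hr0)
  lift t to Finset (Eucl p) using htfin
  set v := chartLip p d K ^ d * (r ^ d * unitBallVolume d) with hv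
  have hv0 : 0 ≤ v := by
    have := unitBallVolume_pos d
    positivity
  refine ⟨∑ _y ∈ t, v + 1, by positivity, fun M hM => ?_⟩
  have hball : ∀ y, volumeOn d M (Metric.ball y (r / 2)) ≤ ENNReal.ofReal v := by
    intro y
    rcases (Metric.ball y (r / 2) ∩ M).eq_empty_or_nonempty with h | ⟨x, hxy, hx⟩
    · rw [volumeOn, Measure.restrict_apply measurableSet_ball, h]
      simp
    · refine le_trans (measure_mono ?_) (hM.volumeOn_ball_le hd hp hK hs hx hr0 le_rfl)
      refine Metric.ball_subset_ball' ?_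
      rw [dist_comm]
      linarith [Metric.mem_ball.1 hxy]
  have huniv : volumeOn d M univ ≤ volumeOn d M (⋃ y ∈ t, Metric.ball y (r / 2)) := by
    have hmeas : MeasurableSet (⋃ y ∈ t, Metric.ball y (r / 2)) :=
      t.measurableSet_biUnion fun _ _ => measurableSet_ball
    rw [volumeOn, Measure.restrict_apply MeasurableSet.univ, Measure.restrict_apply hmeas]
    refine measure_mono fun x hx => ⟨?_, hx.2⟩
    simpa using hcov (Metric.ball_subset_closedBall (hM.subset_ball hx.2))
  calc volumeOn d M univ ≤ ∑ y ∈ t, volumeOn d M (Metric.ball y (r / 2)) :=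
        huniv.trans (measure_biUnion_finset_le _ _)
    _ ≤ ∑ _y ∈ t, ENNReal.ofReal v := Finset.sum_le_sum fun y _ => hball y
    _ = ENNReal.ofReal (∑ _y ∈ t, v) := (ENNReal.ofReal_sum_of_nonneg fun _ _ => hv0).symm
    _ ≤ ENNReal.ofReal (∑ _y ∈ t, v + 1) := ENNReal.ofReal_le_ofReal (by linarith)

variable {μ : Measure (Eucl p)} {f : Eucl p → ℝ}

lemma IsDensityOn.apply_eq (hf : IsDensityOn d M μ f) {A : Set (Eucl p)} (hA : MeasurableSet A) :
    μ A = ∫⁻ x in A ∩ M, ENNReal.ofReal (f x) ∂Measure.euclideanHausdorffMeasure d := by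
  rw [hf.2, withDensity_apply _ hA, volumeOn, Measure.restrict_restrict hA]

lemma IsDensityOn.le_of_le (hM : MeasurableSet M) (hf : IsDensityOn d M μ f) {A : Set (Eucl p)}
    (hA : MeasurableSet A) {c v : ℝ} (hc : 0 ≤ c) (hv : 0 ≤ v) (h : ∀ x ∈ A ∩ M, f x ≤ c)
    (hvol : volumeOn d M A ≤ ENNReal.ofReal v) : μ.real A ≤ c * v := by
  refine ENNReal.toReal_le_of_le_ofReal (by positivity) ?_
  rw [hf.apply_eq hA, ENNReal.ofReal_mul hc]
  calc ∫⁻ x in A ∩ M, ENNReal.ofReal (f x) ∂Measure.euclideanHausdorffMeasure d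
      ≤ ∫⁻ _ in A ∩ M, ENNReal.ofReal c ∂Measure.euclideanHausdorffMeasure d :=
        setLIntegral_mono' (hA.inter hM) fun x hx => ENNReal.ofReal_le_ofReal (h x hx)
    _ = ENNReal.ofReal c * volumeOn d M A := by
        rw [setLIntegral_const, volumeOn, Measure.restrict_apply hA]
    _ ≤ ENNReal.ofReal c * ENNReal.ofReal v := by gcongr

lemma IsDensityOn.le_of_ge [IsFiniteMeasure μ] (hM : MeasurableSet M) (hf : IsDensityOn d M μ f)
    {A : Set (Eucl p)} (hA : MeasurableSet A) {c v : ℝ} (hc : 0 ≤ c) (h : ∀ x ∈ A ∩ M, c ≤ f x)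
    (hvol : ENNReal.ofReal v ≤ volumeOn d M A) : c * v ≤ μ.real A := by
  refine (ENNReal.ofReal_le_iff_le_toReal (measure_ne_top μ A)).1 ?_
  rw [hf.apply_eq hA, ENNReal.ofReal_mul hc]
  calc ENNReal.ofReal c * ENNReal.ofReal v ≤ ENNReal.ofReal c * volumeOn d M A := by gcongr
    _ = ∫⁻ _ in A ∩ M, ENNReal.ofReal c ∂Measure.euclideanHausdorffMeasure d := by
        rw [setLIntegral_const, volumeOn, Measure.restrict_apply hA]
    _ ≤ ∫⁻ x in A ∩ M, ENNReal.ofReal (f x) ∂Measure.euclideanHausdorffMeasure d :=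
        setLIntegral_mono' (hA.inter hM) fun x hx => ENNReal.ofReal_le_ofReal (h x hx)

lemma IsDensityOn.ae_mem (hM : MeasurableSet M) (hf : IsDensityOn d M μ f) : ∀ᵐ x ∂μ, x ∈ M := by
  rw [ae_iff]
  change μ Mᶜ = 0
  rw [hf.apply_eq hM.compl]
  simp

end

/-! ### Bump functions and separation of the measures -/

/-- A continuous function with values in `[0, 1]`, equal to `1` on the ball of radius `σ` and to `0`
outside the ball of radius `2 σ`. -/
noncomputable def bump {p : ℕ} (σ : ℝ) (x : Eucl p) : ℝ := max 0 (min 1 (2 - ‖x‖ / σ))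

section Bump

variable {p : ℕ} {σ : ℝ}

lemma continuous_bump : Continuous (bump σ : Eucl p → ℝ) := by
  unfold bump
  fun_prop

lemma bump_nonneg (x : Eucl p) : 0 ≤ bump σ x := le_max_left _ _

lemma bump_le_one (x : Eucl p) : bump σ x ≤ 1 := max_le zero_le_one (min_le_left _ _)

lemma abs_bump_le_one (x : Eucl p) : |bump σ x| ≤ 1 := by
  rw [abs_of_nonneg (bump_nonneg x)]
  exact bump_le_one x

lemma bump_eq_one (hσ : 0 < σ) {x : Eucl p} (hx : ‖x‖ < σ) : bump σ x = 1 := by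
  have : ‖x‖ / σ < 1 := (div_lt_one hσ).2 hx
  rw [bump, min_eq_left (by linarith), max_eq_right zero_le_one]

lemma bump_eq_zero (hσ : 0 < σ) {x : Eucl p} (hx : 2 * σ ≤ ‖x‖) : bump σ x = 0 := by
  have : 2 ≤ ‖x‖ / σ := (le_div_iff₀ hσ).2 hx
  rw [bump, max_eq_left]
  exact (min_le_right _ _).trans (by linarith)

variable (μ : Measure (Eucl p)) [IsProbabilityMeasure μ] (x₀ : Eucl p)

lemma integrable_bump_sub : Integrable (fun x => bump σ (x - x₀)) μ :=
  Integrable.of_bound (continuous_bump.comp (continuous_id.sub continuous_const)).aestronglyMeasurable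
    1 (Eventually.of_forall fun _ => abs_bump_le_one _)

lemma integral_bump_sub_le (hσ : 0 < σ) :
    ∫ x, bump σ (x - x₀) ∂μ ≤ μ.real (Metric.ball x₀ (2 * σ)) := by
  rw [← integral_indicator_one measurableSet_ball]
  refine integral_mono (integrable_bump_sub μ x₀)
    ((integrable_const (1 : ℝ)).indicator measurableSet_ball) fun x => ?_
  by_cases hx : x ∈ Metric.ball x₀ (2 * σ)
  · simpa [hx] using bump_le_one (x - x₀)
  · have : 2 * σ ≤ ‖x - x₀‖ := by simpa [dist_eq_norm] using hx
    simp [hx, bump_eq_zero hσ this]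

lemma le_integral_bump_sub (hσ : 0 < σ) :
    μ.real (Metric.ball x₀ σ) ≤ ∫ x, bump σ (x - x₀) ∂μ := by
  rw [← integral_indicator_one measurableSet_ball]
  refine integral_mono ((integrable_const (1 : ℝ)).indicator measurableSet_ball)
    (integrable_bump_sub μ x₀) fun x => ?_
  by_cases hx : x ∈ Metric.ball x₀ σ
  · have : ‖x - x₀‖ < σ := by simpa [dist_eq_norm] using hx
    simp [hx, bump_eq_one hσ this]
  · simpa [hx] using bump_nonneg (x - x₀)

end Bump

/-- If `f` is a density on a connected `M` that comes below a small level `t`, then `f` takes the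
value `t` on `M`. -/
lemma exists_density_eq {p d : ℕ} {s s' K V t : ℝ} {M : Set (Eucl p)} {μ : Measure (Eucl p)}
    [IsProbabilityMeasure μ] {f : Eucl p → ℝ} (hd : 1 ≤ d) (hp : 1 ≤ p) (hK : 1 ≤ K) (hs : 1 ≤ s)
    (hs' : 1 ≤ s') (hM : ManifoldCondition d s K M) (hconn : IsConnected M)
    (hf : IsDensityOn d M μ f) (hfs : InHolderBallManifold d s' K M f) (hV : 0 < V)
    (hvol : volumeOn d M univ ≤ ENNReal.ofReal V) (ht : 0 < t) (htV : t * V < 1)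
    (hinf : sInf (f '' M) < t) : ∃ x ∈ M, f x = t := by
  obtain ⟨_, ⟨x₁, hx₁, rfl⟩, h₁⟩ := exists_lt_of_csInf_lt (hconn.nonempty.image f) hinf
  -- A density below `t` everywhere would have total mass at most t V < 1.
  obtain ⟨x₂, hx₂, h₂⟩ : ∃ x ∈ M, t ≤ f x := by
    by_contra! h
    have := hf.le_of_le hM.closedSubmanifold.1.measurableSet MeasurableSet.univ ht.le hV.le
      (fun x hx => (h x hx.2).le) hvol
    rw [probReal_univ] at this
    linarith
  obtain ⟨x, hx, hxt⟩ := hconn.isPreconnected.intermediate_value hx₁ hx₂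
    (hfs.continuousOn hd hp hK hs hs' hM) ⟨h₁.le, h₂⟩
  exact ⟨x, hx, hxt⟩

/-- A measure with a density on a connected manifold that is somewhere small differs from every
measure with a density bounded below, when tested against a bump of one of two fixed sizes. -/
lemma exists_le_abs_integral_bump_sub {p d : ℕ} {K : ℝ} (hd : 1 ≤ d) (hp : 1 ≤ p) (hK : 1 ≤ K) :
    ∃ t c ρ : ℝ, 0 < t ∧ 0 < c ∧ 0 < ρ ∧
      ∀ (M Mstar : Set (Eucl p)) (μ μstar : Measure (Eucl p)) [IsProbabilityMeasure μ]
        [IsProbabilityMeasure μstar] (f : Eucl p → ℝ), IsConnected M →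
        ManifoldCondition d 2 K M → ManifoldCondition d 2 K Mstar →
        DensityCondition d 0 K Mstar μstar → IsDensityOn d M μ f →
        InHolderBallManifold d 1 K M f → sInf (f '' M) < t →
        ∃ x₀ ∈ M, ∃ σ ∈ ({ρ / 2, 2 * ρ} : Set ℝ),
          c ≤ |∫ x, bump σ (x - x₀) ∂μ - ∫ x, bump σ (x - x₀) ∂μstar| := by
  obtain ⟨V, hV, hvol⟩ := exists_volumeOn_univ_le (s := 2) hd hp hK one_le_two
  have hK0 : 0 < K := by linarith
  have hd0 : (0 : ℝ) < d := by exact_mod_cast hd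
  have hr := chartRadius_pos hd hp hK
  have hL := one_le_chartLip hd hp hK
  have hω := unitBallVolume_pos d
  set r := chartRadius p d K
  set L := chartLip p d K with hLdef
  set ω := unitBallVolume d
  have hL0 : 0 < L := by linarith
  -- The first term makes t V < 1. The second makes the mass of μ near x₀ at most half the lower
  -- bound for the mass of μstar; it does not involve ρ, as both scale like ρ ^ d.
  set t := min (2 * V)⁻¹ (4 * K * (4 * L ^ 2) ^ d)⁻¹ with htdef
  have ht : 0 < t := lt_min (by positivity) (by positivity)
  have htV : t * V < 1 := by
    have h1 : t ≤ (2 * V)⁻¹ := min_le_left _ _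
    have h2 : (2 * V)⁻¹ * V = 1 / 2 := by field_simp
    have h3 : t * V ≤ (2 * V)⁻¹ * V := by gcongr
    linarith
  -- On a ball of radius 4 ρ the charts are controlled and the density varies by at most t / 2.
  set ρ := min (r / 4) (t / (8 * (d * K))) / 2 with hρdef
  have hρ : 0 < ρ := half_pos (lt_min (by positivity) (by positivity))
  have hρr : 4 * ρ < r := by
    have : min (r / 4) (t / (8 * (d * K))) ≤ r / 4 := min_le_left _ _
    linarith
  have hρt : d * K * (4 * ρ) ≤ t / 2 := by
    have h1 : min (r / 4) (t / (8 * (d * K))) ≤ t / (8 * (d * K)) := min_le_right _ _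
    have h2 : ρ ≤ t / (8 * (d * K)) := by linarith
    calc d * K * (4 * ρ) ≤ d * K * (4 * (t / (8 * (d * K)))) := by gcongr
      _ = t / 2 := by field_simp; norm_num
  set c₁ := t / 2 * ((ρ / 2 / L) ^ d * ω)
  set c₂ := K⁻¹ * ((ρ / L) ^ d * ω) / 2 with hc₂
  have hsmall : 2 * t * (L ^ d * ((4 * ρ) ^ d * ω)) ≤ c₂ := by
    have h1 : t ≤ (4 * K * (4 * L ^ 2) ^ d)⁻¹ := min_le_right _ _
    calc 2 * t * (L ^ d * ((4 * ρ) ^ d * ω))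
        ≤ 2 * (4 * K * (4 * L ^ 2) ^ d)⁻¹ * (L ^ d * ((4 * ρ) ^ d * ω)) := by gcongr
      _ = c₂ := by
        rw [hc₂]
        simp only [mul_pow, div_pow]
        field_simp
        ring
  refine ⟨t, min c₁ c₂, ρ, ht, lt_min (by positivity) (by positivity), hρ, ?_⟩
  intro M Mstar μ μstar _ _ f hconn hM hMstar hstar hf hfs hinf
  obtain ⟨fstar, hfstar, -, hlow⟩ := hstar
  have hMm := hM.closedSubmanifold.1.measurableSet
  have hMstarm := hMstar.closedSubmanifold.1.measurableSet
  obtain ⟨x₀, hx₀, hfx₀⟩ := exists_density_eq hd hp hK one_le_two le_rfl hM hconn hf hfs hV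
    (hvol M hM) ht htV hinf
  have hnear : ∀ x ∈ Metric.ball x₀ (4 * ρ) ∩ M, |f x - t| ≤ t / 2 := by
    rintro x ⟨hx, hxM⟩
    have hx' : dist x x₀ < 4 * ρ := hx
    rw [← hfx₀]
    refine (hfs.abs_sub_le hd hp hK one_le_two le_rfl hM hx₀ hxM (hx'.trans hρr)).trans ?_
    rw [hfx₀]
    exact le_trans (by gcongr) hρt
  refine ⟨x₀, hx₀, ?_⟩
  -- If `Mstar` misses the ball of radius ρ, the bump of size ρ / 2 is invisible to μstar. Otherwise
  -- the bump of size 2 ρ equals 1 on a ball of radius ρ about a point `y` of `Mstar`, and vanishes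
  -- outside the ball of radius 4 ρ about x₀.
  rcases (Metric.ball x₀ ρ ∩ Mstar).eq_empty_or_nonempty with hempty | ⟨y, hyx, hy⟩
  · refine ⟨ρ / 2, by simp, (min_le_left _ _).trans (le_trans ?_ (le_abs_self _))⟩
    have h1 : c₁ ≤ μ.real (Metric.ball x₀ (ρ / 2)) := by
      refine hf.le_of_ge hMm measurableSet_ball (by positivity) (fun x hx => ?_)
        (hM.le_volumeOn_ball hd hp hK one_le_two hx₀ (by positivity) (by linarith))
      have := abs_le.1 (hnear x ⟨Metric.ball_subset_ball (by linarith) hx.1, hx.2⟩)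
      linarith
    have h2 : μstar.real (Metric.ball x₀ (2 * (ρ / 2))) = 0 := by
      rw [show 2 * (ρ / 2) = ρ by ring, measureReal_def, hfstar.apply_eq measurableSet_ball, hempty]
      simp
    have h3 := le_integral_bump_sub μ x₀ (half_pos hρ)
    have h4 := integral_bump_sub_le μstar x₀ (half_pos hρ)
    linarith
  · refine ⟨2 * ρ, by simp, (min_le_right _ _).trans ?_⟩
    rw [abs_sub_comm]
    refine le_trans ?_ (le_abs_self _)
    have h1 : μ.real (Metric.ball x₀ (2 * (2 * ρ))) ≤ 2 * t * (L ^ d * ((4 * ρ) ^ d * ω)) := by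
      rw [show 2 * (2 * ρ) = 4 * ρ by ring]
      refine hf.le_of_le hMm measurableSet_ball (by positivity) (by positivity) (fun x hx => ?_)
        (hM.volumeOn_ball_le hd hp hK one_le_two hx₀ (by positivity) hρr.le)
      have := abs_le.1 (hnear x hx)
      linarith
    have h2 : K⁻¹ * ((ρ / L) ^ d * ω) ≤ μstar.real (Metric.ball y ρ) :=
      hfstar.le_of_ge hMstarm measurableSet_ball (by positivity) (fun x hx => hlow x hx.2)
        (hMstar.le_volumeOn_ball hd hp hK one_le_two hy hρ (by linarith))
    have h3 : μstar.real (Metric.ball y ρ) ≤ μstar.real (Metric.ball x₀ (2 * ρ)) := by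
      refine measureReal_mono (Metric.ball_subset_ball' ?_)
      linarith [Metric.mem_ball.1 hyx]
    have h4 := le_integral_bump_sub μstar x₀ (σ := 2 * ρ) (by positivity)
    have h5 := integral_bump_sub_le μ x₀ (σ := 2 * ρ) (by positivity)
    linarith

end HolderIPM

theorem mainTheorem8 (p d : ℕ) (hd : 1 ≤ d) (hdp : d < p) (K : ℝ) (hK : 1 < K) :
    ∃ C : ℝ, 0 < C ∧ ∀ η : ℝ, 0 < η → ∃ Cη : ℝ, 0 < Cη ∧
      ∀ (M Mstar : Set (HolderIPM.Eucl p)) (μ μstar : Measure (HolderIPM.Eucl p))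
        [IsProbabilityMeasure μ] [IsProbabilityMeasure μstar] (f : HolderIPM.Eucl p → ℝ),
        IsConnected M →
        HolderIPM.ManifoldCondition d 2 K M →
        HolderIPM.ManifoldCondition d 2 K Mstar →
        HolderIPM.DensityCondition d 0 K Mstar μstar →
        HolderIPM.IsDensityOn d M μ f →
        HolderIPM.InHolderBallManifold d 1 K M f →
        sInf (f '' M) ≤ Cη⁻¹ →
          C⁻¹ ≤ HolderIPM.holderIPM η μ μstar ∧
          ∀ γ : ℝ, 0 < γ →
            HolderIPM.holderIPM γ μ μstar ≤ C * HolderIPM.holderIPM η μ μstar := by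
  have hp : 1 ≤ p := by omega
  obtain ⟨t, c, ρ, ht, hc, hρ, hsep⟩ :=
    HolderIPM.exists_le_abs_integral_bump_sub (p := p) hd hp hK.le
  obtain ⟨A₁, hA₁, h₁⟩ := HolderIPM.exists_abs_integral_sub_le (p := p)
    (HolderIPM.continuous_bump (σ := ρ / 2)) HolderIPM.abs_bump_le_one (2 * K) (half_pos hc)
  obtain ⟨A₂, hA₂, h₂⟩ := HolderIPM.exists_abs_integral_sub_le (p := p)
    (HolderIPM.continuous_bump (σ := 2 * ρ)) HolderIPM.abs_bump_le_one (2 * K) (half_pos hc)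
  set A := A₁ + A₂ + 1 with hA
  have hA0 : 0 < A := by positivity
  -- The approximation error c / 2 leaves d_η ≥ c / (2 A). This exceeds 1 / C, and C times it equals
  -- 2, the trivial bound for every d_γ. The value 2 / t makes the infimum at most t / 2, strictly
  -- below t.
  refine ⟨4 * A / c, by positivity, fun η hη => ⟨2 / t, by positivity, ?_⟩⟩
  intro M Mstar μ μstar _ _ f hconn hM hMstar hstar hf hfs hinf
  have hinf' : sInf (f '' M) < t := by
    rw [inv_div] at hinf
    linarith
  obtain ⟨x₀, hx₀, σ, hσ, hle⟩ := hsep M Mstar μ μstar f hconn hM hMstar hstar hf hfs hinf'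
  have hsupp : ∀ x ∈ Metric.ball (0 : HolderIPM.Eucl p) K, x ∈ Metric.closedBall x₀ (2 * K) := by
    intro x hx
    have h0 := hM.subset_ball hx₀
    rw [Metric.mem_ball, dist_comm] at h0
    rw [Metric.mem_closedBall]
    linarith [dist_triangle x 0 x₀, Metric.mem_ball.1 hx]
  have hμ : ∀ᵐ x ∂μ, x ∈ Metric.closedBall x₀ (2 * K) :=
    (hf.ae_mem hM.closedSubmanifold.1.measurableSet).mono fun x hx => hsupp x (hM.subset_ball hx)
  have hμstar : ∀ᵐ x ∂μstar, x ∈ Metric.closedBall x₀ (2 * K) := by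
    obtain ⟨fstar, hfstar, -⟩ := hstar
    exact (hfstar.ae_mem hMstar.closedSubmanifold.1.measurableSet).mono
      fun x hx => hsupp x (hMstar.subset_ball hx)
  set I := HolderIPM.holderIPM η μ μstar
  have hI : 0 ≤ I := by
    have := HolderIPM.abs_integral_planeWave_sub_le μ μstar hη.le (b := 0) (by simp) 0
    linarith [(abs_nonneg _).trans this]
  have hbound : c ≤ A * I + c / 2 := by
    rcases hσ with rfl | rfl
    · have := h₁ η μ μstar x₀ hη.le hμ hμstar
      have : A₁ * I ≤ A * I := by gcongr; linarith
      linarith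
    · have := h₂ η μ μstar x₀ hη.le hμ hμstar
      have : A₂ * I ≤ A * I := by gcongr; linarith
      linarith
  have hcI : c / (2 * A) ≤ I := by
    rw [div_le_iff₀ (by positivity)]
    linarith
  refine ⟨?_, fun γ hγ => ?_⟩
  · rw [inv_div]
    refine le_trans ?_ hcI
    gcongr
    norm_num
  · calc HolderIPM.holderIPM γ μ μstar ≤ 2 := HolderIPM.holderIPM_le_two μ μstar hγ.le
      _ = 4 * A / c * (c / (2 * A)) := by field_simp; norm_num
      _ ≤ 4 * A / c * I := by gcongr
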